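/- All Hilbert spaces are finite-dimensional. A state on $A_1\cdots A_n$ is a positive semidefinite operator of trace one on $\mathcal H_{A_1}\otimes\cdots\otimes\mathcal H_{A_n}$; it is pure if it is a rank-one projector $|\psi\rangle\langle\psi|$. For a set $\mathcal S$ of parties, $\rho_{\mathcal S}=\operatorname{Tr}_{\mathcal S^c}\rho$ is the marginal on $\mathcal S$ (a $k$-marginal if $|\mathcal S|=k$). A state $\rho$ is $k$-UDA if no state $\sigma\neq\rho$, pure or mixed, has $\sigma_{\mathcal S}=\rho_{\mathcal S}$ for all $\mathcal S$ with $|\mathcal S|=k$. Two states are LU equivalent if they are conjugate by a tensor product of one unitary per party. Say that a two-qubit state $\eta$ is of type $(\ast)$ if, in the ordered basis $|00\rangle,|01\rangle,|10\rangle,|11\rangle$, $$\eta=D\oplus 0,\qquad D=\begin{bmatrix} q_1&y&z\\ y^*&q_2&x\\ z^*&x^*&q_3\end{bmatrix},\qquad q_1q_2q_3>0 .$$ All tensor factors below are states. (i) Let $1\le k\le n$. The $n$-partite state $\rho=\bigotimes_{i=1}^n\rho_{A_i}$ (arbitrary finite local dimensions) is $k$-UDA if and only if at least $n-k$ of its 1-marginals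 $\rho_{A_i}$ are pure. (ii) Let $n\ge 2$. If $\rho_{A_{n-1}}$ or $\rho_{A_n}$ is pure, the $n$-qubit state $\rho=\bigotimes_{i=1}^{n-2}\rho_{A_i}\otimes\rho_{A_{n-1}A_n}$ equals $\bigotimes_{i=1}^n\rho_{A_i}$. In general, $\rho$ is $2$-UDA if and only if one of the following holds: (a) $\rho_{A_{n-1}A_n}$ is pure, and at least $n-4$ of $\rho_{A_1},\dots,\rho_{A_{n-2}}$ are pure; (b) $\rho_{A_{n-1}}$ or $\rho_{A_n}$ is pure, and at least $n-2$ of $\rho_{A_1},\dots,\rho_{A_n}$ are pure; (c) $\bigotimes_{i=1}^{n-2}\rho_{A_i}$ is pure ($\rho_{A_{n-1}A_n}$ being arbitrary); (d) at least $n-3$ of $\rho_{A_1},\dots,\rho_{A_{n-2}}$ are pure, and $\rho_{A_{n-1}A_n}$ has rank two and is LU equivalent to a state of type $(\ast)$. (iii) Let $n\ge 4$. If one of the two 1-marginals of $\rho_{A_{n-3}A_{n-2}}$ (resp. $\rho_{A_{n-1}A_n}$) is pure, that two-qubit state is the product of its 1-marginals. The $n$-qubit state $\rho=\bigotimes_{i=1}^{n-4}\rho_{A_i}\otimes\rho_{A_{n-3}A_{n-2}}\otimes\rho_{A_{n-1}A_n}$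 is $2$-UDA if and only if one of the following holds: (a) one of $\rho_{A_{n-3}A_{n-2}}$, $\rho_{A_{n-1}A_n}$ is pure and, with $\rho_{A_{j_1}A_{j_2}}$ the other one, the $(n-2)$-qubit state $\bigotimes_{i=1}^{n-4}\rho_{A_i}\otimes\rho_{A_{j_1}A_{j_2}}$ satisfies one of the conditions (a)–(d) of (ii); (b) $\rho_{A_j}$ is pure for some $j\in\{n-3,\dots,n\}$ and, with $A_l$ the party paired with $A_j$ and $A_{m_1}A_{m_2}$ the other pair, the $n$-qubit state $\bigotimes_{i=1}^{n-4}\rho_{A_i}\otimes\rho_{A_j}\otimes\rho_{A_l}\otimes\rho_{A_{m_1}A_{m_2}}$ satisfies one of the conditions (a)–(d) of (ii); (c) $\rho_{A_{n-3}A_{n-2}}$ and $\rho_{A_{n-1}A_n}$ have rank two, $\rho_{A_{n-3}A_{n-2}}\otimes\rho_{A_{n-1}A_n}$ is LU equivalent to a product of two states of type $(\ast)$, and $\bigotimes_{i=1}^{n-4}\rho_{A_i}$ is pure. -/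

import Mathlib

open scoped ComplexOrder

namespace QuantumMarginal

/-- A density matrix on the finite-dimensional Hilbert space with orthonormal basis `X`. -/
def IsState {X : Type*} [Fintype X] (ρ : Matrix X X ℂ) : Prop :=
  ρ.PosSemidef ∧ ρ.trace = 1

/-- The matrix is a rank-one projector `|ψ⟩⟨ψ|` onto a unit vector `ψ`. -/
def IsPure {X : Type*} [Fintype X] (ρ : Matrix X X ℂ) : Prop :=
  ∃ ψ : X → ℂ, star ψ ⬝ᵥ ψ = 1 ∧ ρ = Matrix.vecMulVec ψ (star ψ)

section Multipartite

variable {ι : Type*} [Fintype ι] [DecidableEq ι] {κ : ι → Type*}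
  [∀ i, Fintype (κ i)] [∀ i, DecidableEq (κ i)]

/-- The configuration of all parties that is `x` on the parties in `S` and `z` on the others. -/
def glue (S : Finset ι) (x : ∀ i : {i // i ∈ S}, κ i) (z : ∀ i : {i // i ∉ S}, κ i) :
    ∀ i, κ i :=
  fun i => if h : i ∈ S then x ⟨i, h⟩ else z ⟨i, h⟩

/-- The marginal (reduced density matrix) on the parties in `S`: the partial trace over the
parties outside `S` of an operator on `⨂ i, ℂ^(κ i)`. -/
def marginal (S : Finset ι) (ρ : Matrix (∀ i, κ i) (∀ i, κ i) ℂ) :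
    Matrix (∀ i : {i // i ∈ S}, κ i) (∀ i : {i // i ∈ S}, κ i) ℂ :=
  fun x y => ∑ z : ∀ i : {i // i ∉ S}, κ i, ρ (glue S x z) (glue S y z)

/-- `σ` has the same `k`-partite marginals as `ρ`. -/
def Compatible (k : ℕ) (σ ρ : Matrix (∀ i, κ i) (∀ i, κ i) ℂ) : Prop :=
  ∀ S : Finset ι, S.card = k → marginal S σ = marginal S ρ

/-- `ρ` is `k`-uniquely determined among all states: no other (pure or mixed) state has the
same `k`-partite marginals. -/
def IsUDA (k : ℕ) (ρ : Matrix (∀ i, κ i) (∀ i, κ i) ℂ) : Prop :=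
  ∀ σ : Matrix (∀ i, κ i) (∀ i, κ i) ℂ, IsState σ → Compatible k σ ρ → σ = ρ

/-- The tensor product `⨂ i, M i` of one operator for each party. -/
def prodOp (M : ∀ i, Matrix (κ i) (κ i) ℂ) : Matrix (∀ i, κ i) (∀ i, κ i) ℂ :=
  fun x y => ∏ i, M i (x i) (y i)

/-- Equivalence under local unitaries: `η = (⨂ U i) ρ (⨂ U i)†`. -/
def LUEquiv (ρ η : Matrix (∀ i, κ i) (∀ i, κ i) ℂ) : Prop :=
  ∃ U : ∀ i, Matrix (κ i) (κ i) ℂ, (∀ i, U i ∈ Matrix.unitaryGroup (κ i) ℂ) ∧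
    η = prodOp U * ρ * (prodOp U).conjTranspose

/-- The number of parties whose 1-marginal is pure. -/
noncomputable def pureCount (ρ : Matrix (∀ i, κ i) (∀ i, κ i) ℂ) : ℕ :=
  {i : ι | IsPure (marginal {i} ρ)}.ncard

/-- At least `n - k` of the 1-marginals of an `n`-partite operator are pure. -/
def AllButPure (k : ℕ) (ρ : Matrix (∀ i, κ i) (∀ i, κ i) ℂ) : Prop :=
  Fintype.card ι - k ≤ pureCount ρ

end Multipartite

/-- Operators on `n` qubits, in the computational basis. -/
abbrev QubitOp (n : ℕ) : Type := Matrix (Fin n → Fin 2) (Fin n → Fin 2) ℂ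

/-- The tensor product of an operator on `m` qubits and one on the `l` qubits that follow. -/
def tensor {m l : ℕ} (α : QubitOp m) (β : QubitOp l) : QubitOp (m + l) :=
  fun x y =>
    α (fun i => x (Fin.castAdd l i)) (fun i => y (Fin.castAdd l i)) *
      β (fun j => x (Fin.natAdd m j)) (fun j => y (Fin.natAdd m j))

/-- The 1-marginal of the `i`-th qubit, as a `2 × 2` matrix. -/
def qubitMarginal {n : ℕ} (ρ : QubitOp n) (i : Fin n) : Matrix (Fin 2) (Fin 2) ℂ :=
  fun a b => marginal {i} ρ (fun _ => a) (fun _ => b)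

/-- The position of a two-qubit basis vector in the order `00, 01, 10, 11`. -/
def pos (x : Fin 2 → Fin 2) : Fin 4 :=
  finProdFinEquiv (x 0, x 1)

/-- A two-qubit state of the form `D ⊕ 0`, where the `3 × 3` matrix `D` has diagonal
`q₁, q₂, q₃` with `q₁ q₂ q₃ > 0`. -/
def IsCornerForm (η : QubitOp 2) : Prop :=
  IsState η ∧ ∃ (q₁ q₂ q₃ : ℝ) (x y z : ℂ), 0 < q₁ * q₂ * q₃ ∧
    η = Matrix.submatrix
      !![(q₁ : ℂ), y, z, 0;
         star y, (q₂ : ℂ), x, 0;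
         star z, star x, (q₃ : ℂ), 0;
         0, 0, 0, 0] pos pos

/-- The conditions under which `(⨂_{i ≤ m} σ i) ⊗ τ` is claimed to be 2-UDA; here
`n = m + 2`. -/
def OnePairCondition {m : ℕ} (σ : Fin m → Matrix (Fin 2) (Fin 2) ℂ) (τ : QubitOp 2) : Prop :=
  (IsPure τ ∧ AllButPure 2 (prodOp σ)) ∨
  ((IsPure (qubitMarginal τ 0) ∨ IsPure (qubitMarginal τ 1)) ∧
    AllButPure 2 (tensor (prodOp σ) τ)) ∨
  IsPure (prodOp σ) ∨
  (AllButPure 1 (prodOp σ) ∧ τ.rank = 2 ∧ ∃ η, IsCornerForm η ∧ LUEquiv τ η)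

/-- The conditions under which `(⨂_{i ≤ m} σ i) ⊗ τ₁ ⊗ τ₂` is claimed to be 2-UDA; here
`n = m + 4`. -/
def TwoPairCondition {m : ℕ} (σ : Fin m → Matrix (Fin 2) (Fin 2) ℂ) (τ₁ τ₂ : QubitOp 2) :
    Prop :=
  ((IsPure τ₁ ∧ OnePairCondition σ τ₂) ∨ (IsPure τ₂ ∧ OnePairCondition σ τ₁)) ∨
  (((IsPure (qubitMarginal τ₁ 0) ∨ IsPure (qubitMarginal τ₁ 1)) ∧
      OnePairCondition (Fin.append σ (qubitMarginal τ₁)) τ₂) ∨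
    ((IsPure (qubitMarginal τ₂ 0) ∨ IsPure (qubitMarginal τ₂ 1)) ∧
      OnePairCondition (Fin.append σ (qubitMarginal τ₂)) τ₁)) ∨
  (τ₁.rank = 2 ∧ τ₂.rank = 2 ∧
    (∃ η₁ η₂, IsCornerForm η₁ ∧ IsCornerForm η₂ ∧ LUEquiv (tensor τ₁ τ₂) (tensor η₁ η₂)) ∧
    IsPure (prodOp σ))

end QuantumMarginal

namespace QuantumMarginal

open Matrix

/-! ### Linear algebra on the range of a positive semidefinite matrix -/

section Single

variable {X : Type*} [Fintype X]

/-! Being `k`-UDA is turned into a linear condition. For the states considered here, any state with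
the same `k`-marginals as `ρ` lives on the range of `ρ` (`confining_prodOp`, `confining_of_card_le`,
`Confining.tensor`), because an operator of zero expectation on a single factor is already seen by
the marginals. The difference of the two states is then an operator `ρ * Z * ρ` with vanishing
`k`-marginals. Conversely, a nonzero operator of this kind has a nonzero Hermitian part, up to a
factor `i`, and a small multiple of that part can be added to `ρ` without losing positivity. Hence
`k`-UDA means `Rigid ρ k` (`isUDA_iff_rigid`).

The least `k` for which `ρ` is rigid is its weight, and weights add under tensor products
(`HasWeight.tensor`): witnesses of non-rigidity multiply, and an operator on the product is
controlled by contracting one factor at a time. A one-party state has weight 0 if pure and 1 if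
mixed, so a product state has the number of its mixed factors as weight (`hasWeight_prodOp`). This
is (i).

For (ii) and (iii) it remains to find the weight of a two-qubit state. It is at most 2, and 0
exactly for pure states. `rigid_one_iff` decides when it is at most 1. Rank three or more is
excluded by a dimension count, 9 against 8. In rank two the kernel contains a product vector, which
local unitaries move to `|11⟩`; the remaining diagonal entries then separate type (∗), a pure
marginal, and a state for which `|01⟩⟨10| + |10⟩⟨01|` is a witness. All listed conditions thereby
become the single inequality "total weight at most 2". -/

theorem exists_unitary_diagonalization [DecidableEq X] {A : Matrix X X ℂ} (hA : A.IsHermitian) :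
    ∃ (V : Matrix X X ℂ) (d : X → ℝ), Vᴴ * V = 1 ∧ V * Vᴴ = 1 ∧
      A = V * diagonal (fun i => (d i : ℂ)) * Vᴴ := by
  refine ⟨hA.eigenvectorUnitary, hA.eigenvalues, ?_, ?_, ?_⟩
  · exact Unitary.coe_star_mul_self _
  · exact Unitary.coe_mul_star_self _
  · conv_lhs => rw [hA.spectral_theorem, Unitary.conjStarAlgAut_apply]
    rfl

/-- Invert the nonzero eigenvalues and leave the zeros, since `0⁻¹ = 0`. With such a `g`, `A * (1 -
g * A) = 0`, so `1 - g * A` tests for support on `A`. -/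
theorem exists_mul_mul_self [DecidableEq X] {A : Matrix X X ℂ} (hA : A.IsHermitian) :
    ∃ g : Matrix X X ℂ, A * g * A = A := by
  obtain ⟨V, d, h1, -, rfl⟩ := exists_unitary_diagonalization hA
  refine ⟨V * diagonal (fun i => (d i : ℂ)⁻¹) * Vᴴ, ?_⟩
  have key : diagonal (fun i => (d i : ℂ)) * diagonal (fun i => (d i : ℂ)⁻¹) *
      diagonal (fun i => (d i : ℂ)) = diagonal (fun i => (d i : ℂ)) := by
    simp only [diagonal_mul_diagonal, mul_inv_mul_cancel]
  calc _ = V * (diagonal (fun i => (d i : ℂ)) * (Vᴴ * V) * diagonal (fun i => (d i : ℂ)⁻¹) *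
        (Vᴴ * V) * diagonal (fun i => (d i : ℂ))) * Vᴴ := by simp only [Matrix.mul_assoc]
    _ = _ := by rw [h1, Matrix.mul_one, Matrix.mul_one, key]

theorem exists_one_add_smul_posSemidef [DecidableEq X] {H : Matrix X X ℂ} (hH : H.IsHermitian) :
    ∃ ε : ℝ, 0 < ε ∧ (1 + (ε : ℂ) • H).PosSemidef := by
  obtain ⟨V, d, -, h2, rfl⟩ := exists_unitary_diagonalization hH
  -- `c` exceeds every `|d i|`, and the summand 1 keeps it positive even if all eigenvalues vanish.
  set c : ℝ := 1 + ∑ i, |d i| with hc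
  have hcpos : 0 < c := by positivity
  have hd : ∀ i, -c ≤ d i := fun i => by
    have h := Finset.single_le_sum (fun j _ => abs_nonneg (d j)) (Finset.mem_univ i)
    have := neg_abs_le (d i)
    linarith
  refine ⟨c⁻¹, inv_pos.2 hcpos, ?_⟩
  have : (1 : Matrix X X ℂ) + ((c⁻¹ : ℝ) : ℂ) • (V * diagonal (fun i => (d i : ℂ)) * Vᴴ) =
      V * diagonal (fun i => ((1 + c⁻¹ * d i : ℝ) : ℂ)) * Vᴴ := by
    have e : diagonal (fun i => ((1 + c⁻¹ * d i : ℝ) : ℂ)) =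
        1 + ((c⁻¹ : ℝ) : ℂ) • diagonal (fun i => (d i : ℂ)) := by
      ext i j
      by_cases h : i = j
      · subst h; simp
      · simp [h]
    rw [e, Matrix.mul_add, Matrix.add_mul, Matrix.mul_one, h2, Matrix.mul_smul, Matrix.smul_mul]
  rw [this]
  refine PosSemidef.mul_mul_conjTranspose_same (PosSemidef.diagonal fun i => ?_) V
  have h0 : (0 : ℝ) ≤ 1 + c⁻¹ * d i := by
    have := mul_le_mul_of_nonneg_left (hd i) (inv_pos.2 hcpos).le
    have h1 : c⁻¹ * c = 1 := inv_mul_cancel₀ hcpos.ne'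
    linarith
  simpa using (Complex.zero_le_real.2 h0)

/-- `X` lives on the range of `ρ` (on both sides, for Hermitian `ρ`). -/
def Supp (ρ A : Matrix X X ℂ) : Prop := ∃ Z, A = ρ * Z * ρ

theorem Supp.add {ρ A B : Matrix X X ℂ} (hA : Supp ρ A) (hB : Supp ρ B) : Supp ρ (A + B) := by
  obtain ⟨Y, rfl⟩ := hA
  obtain ⟨Z, rfl⟩ := hB
  exact ⟨Y + Z, by rw [Matrix.mul_add, Matrix.add_mul]⟩

theorem Supp.smul {ρ A : Matrix X X ℂ} (hA : Supp ρ A) (c : ℂ) : Supp ρ (c • A) := by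
  obtain ⟨Y, rfl⟩ := hA
  exact ⟨c • Y, by rw [Matrix.mul_smul, Matrix.smul_mul]⟩

theorem Supp.sub {ρ A B : Matrix X X ℂ} (hA : Supp ρ A) (hB : Supp ρ B) : Supp ρ (A - B) := by
  obtain ⟨Y, rfl⟩ := hA
  obtain ⟨Z, rfl⟩ := hB
  exact ⟨Y - Z, by rw [Matrix.mul_sub, Matrix.sub_mul]⟩

theorem Supp.conjTranspose {ρ A : Matrix X X ℂ} (hρ : ρ.IsHermitian) (hA : Supp ρ A) :
    Supp ρ Aᴴ := by
  obtain ⟨Y, rfl⟩ := hA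
  exact ⟨Yᴴ, by simp only [conjTranspose_mul, hρ.eq, Matrix.mul_assoc]⟩

theorem supp_self {ρ : Matrix X X ℂ} (hρ : ρ.IsHermitian) : Supp ρ ρ := by
  classical
  obtain ⟨g, hg⟩ := exists_mul_mul_self hρ
  exact ⟨g, hg.symm⟩

/-- A Hermitian matrix that factors through a Hermitian `ρ` on one side does so on both. -/
theorem supp_of_eq_mul {ρ A Y : Matrix X X ℂ} (hρ : ρ.IsHermitian) (hA : A.IsHermitian)
    (h : A = Y * ρ) : Supp ρ A := by
  classical
  obtain ⟨g, hg⟩ := exists_mul_mul_self hρ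
  have h1 : A * g * ρ = A := by rw [h, Matrix.mul_assoc Y, Matrix.mul_assoc Y, hg]
  have h2 : A = ρ * Yᴴ := by
    rw [← hA.eq, h, conjTranspose_mul, hρ.eq]
  exact ⟨Yᴴ * g, by rw [← Matrix.mul_assoc, ← h2, h1]⟩

/-- A Hermitian matrix whose kernel contains that of a Hermitian `ρ` is supported on `ρ`. -/
theorem supp_of_ker {ρ A : Matrix X X ℂ} (hρ : ρ.IsHermitian) (hA : A.IsHermitian)
    (h : ∀ v, ρ *ᵥ v = 0 → A *ᵥ v = 0) : Supp ρ A := by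
  classical
  obtain ⟨g, hg⟩ := exists_mul_mul_self hρ
  refine supp_of_eq_mul (Y := A * g) hρ hA ?_
  have h0 : A * (1 - g * ρ) = 0 := by
    refine Matrix.ext_of_mulVec_single fun j => ?_
    rw [← Matrix.mulVec_mulVec, Matrix.zero_mulVec]
    apply h
    rw [Matrix.mulVec_mulVec, Matrix.mul_sub, Matrix.mul_one, ← Matrix.mul_assoc, hg, sub_self,
      Matrix.zero_mulVec]
  rw [Matrix.mul_sub, Matrix.mul_one, sub_eq_zero] at h0
  rw [Matrix.mul_assoc]
  exact h0

theorem exists_conjTranspose_mul_self {A : Matrix X X ℂ} (hA : A.PosSemidef) :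
    ∃ B : Matrix X X ℂ, A = Bᴴ * B := by
  classical
  open scoped MatrixOrder in
  obtain ⟨B, hB⟩ := CStarAlgebra.nonneg_iff_eq_star_mul_self.mp hA.nonneg
  exact ⟨B, hB⟩

/-- A Hermitian perturbation supported on a positive semidefinite matrix can be made small enough
to preserve positivity. -/
theorem exists_add_smul_posSemidef {ρ A : Matrix X X ℂ} (hρ : ρ.PosSemidef) (hA : A.IsHermitian)
    (hs : Supp ρ A) : ∃ ε : ℝ, 0 < ε ∧ (ρ + (ε : ℂ) • A).PosSemidef := by
  classical
  obtain ⟨Z, hZ⟩ := hs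
  obtain ⟨B, hB⟩ := exists_conjTranspose_mul_self hρ
  -- Since `A` is Hermitian, `Z` may be replaced by its Hermitian part. With `ρ = Bᴴ * B` the
  -- perturbation then takes place inside `Bᴴ * (1 + ε • H) * B`.
  have hA2 : A = ρ * ((1 / 2 : ℂ) • (Z + Zᴴ)) * ρ := by
    have h' : A = ρ * Zᴴ * ρ := by
      conv_lhs => rw [← hA.eq, hZ]
      simp only [conjTranspose_mul, hρ.1.eq, Matrix.mul_assoc]
    rw [Matrix.mul_smul, Matrix.smul_mul, Matrix.mul_add, Matrix.add_mul, ← hZ, ← h', ← two_smul ℂ,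
      smul_smul]
    norm_num
  set W := (1 / 2 : ℂ) • (Z + Zᴴ) with hW
  have hWh : W.IsHermitian := by
    have e : star (1 / 2 : ℂ) = 1 / 2 := by simp
    rw [IsHermitian, hW, conjTranspose_smul, conjTranspose_add, conjTranspose_conjTranspose, e,
      add_comm]
  obtain ⟨ε, hε, hpos⟩ := exists_one_add_smul_posSemidef (isHermitian_mul_mul_conjTranspose B hWh)
  refine ⟨ε, hε, ?_⟩
  have e : ρ + (ε : ℂ) • A = Bᴴ * (1 + (ε : ℂ) • (B * W * Bᴴ)) * B := by
    rw [hA2, hB]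
    simp only [Matrix.mul_add, Matrix.add_mul, Matrix.mul_one, Matrix.mul_smul, Matrix.smul_mul,
      Matrix.mul_assoc]
  rw [e]
  exact hpos.conjTranspose_mul_mul_same B

/-- With `σ = Bᴴ * B` the trace is the squared Hilbert–Schmidt norm of `B * Q`. Thus a single
expectation value confines `σ`. -/
theorem mul_eq_zero_of_trace_mul_eq_zero {Y : Type*} [Fintype Y] {σ : Matrix X X ℂ}
    (hσ : σ.PosSemidef) {Q : Matrix X Y ℂ} (h : (σ * (Q * Qᴴ)).trace = 0) : σ * Q = 0 := by
  obtain ⟨B, rfl⟩ := exists_conjTranspose_mul_self hσ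
  have h1 : ((B * Q)ᴴ * (B * Q)).trace = 0 := by
    rw [← h, ← Matrix.mul_assoc (Bᴴ * B) Q, Matrix.trace_mul_comm _ Qᴴ, conjTranspose_mul]
    simp only [Matrix.mul_assoc]
  rw [trace_conjTranspose_mul_self_eq_zero_iff] at h1
  rw [Matrix.mul_assoc, h1, Matrix.mul_zero]

theorem IsState.ne_zero {ρ : Matrix X X ℂ} (h : IsState ρ) : ρ ≠ 0 := by
  rintro rfl
  simpa using h.2

theorem IsPure.isState {ρ : Matrix X X ℂ} (h : IsPure ρ) : IsState ρ := by
  obtain ⟨ψ, h1, rfl⟩ := h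
  refine ⟨posSemidef_vecMulVec_self_star ψ, ?_⟩
  rw [trace_vecMulVec, dotProduct_comm, h1]

/-- Compression to a line is a scalar, which is why pure factors contribute no weight. -/
theorem IsPure.mul_mul {ρ : Matrix X X ℂ} (h : IsPure ρ) (M : Matrix X X ℂ) :
    ρ * M * ρ = (ρ * M).trace • ρ := by
  obtain ⟨ψ, -, rfl⟩ := h
  rw [vecMulVec_mul, vecMulVec_mul_vecMulVec, trace_vecMulVec, vecMulVec_smul, dotProduct_comm]

/-- A positive semidefinite matrix of trace one and of the form `w w†` up to scale is pure. -/
theorem isPure_of_smul_eq {ρ : Matrix X X ℂ} (hρ : IsState ρ) {w : X → ℂ} {c : ℂ} (hw : w ≠ 0)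
    (h : c • ρ = vecMulVec w (star w)) : IsPure ρ := by
  have hc : c = star w ⬝ᵥ w := by
    have := congrArg Matrix.trace h
    rwa [trace_smul, hρ.2, trace_vecMulVec, smul_eq_mul, mul_one, dotProduct_comm] at this
  have hpos : 0 < star w ⬝ᵥ w := dotProduct_star_self_pos_iff.2 hw
  obtain ⟨r, hr⟩ : ∃ r : ℝ, (r : ℂ) = c := by
    rw [hc]
    exact ⟨_, (Complex.eq_re_of_ofReal_le (r := 0) (by simp)).symm⟩
  have hr0 : 0 < r := by
    rw [← hc, ← hr] at hpos
    exact_mod_cast hpos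
  have hs : ((Real.sqrt r : ℝ) : ℂ) * ((Real.sqrt r : ℝ) : ℂ) = c := by
    rw [← hr, ← Complex.ofReal_mul, Real.mul_self_sqrt hr0.le]
  have hs0 : ((Real.sqrt r : ℝ) : ℂ) ≠ 0 := by
    exact_mod_cast (Real.sqrt_pos.2 hr0).ne'
  set s : ℂ := ((Real.sqrt r : ℝ) : ℂ)
  have hss : star s = s := Complex.conj_ofReal _
  refine ⟨s⁻¹ • w, ?_, ?_⟩
  · rw [star_smul, smul_dotProduct, dotProduct_smul, ← hc, star_inv₀, hss, ← hs]
    simp only [smul_eq_mul]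
    field_simp
  · rw [star_smul, vecMulVec_smul, smul_vecMulVec, ← h, star_inv₀, hss, ← hs, smul_smul, smul_smul]
    have : s⁻¹ * s⁻¹ * (s * s) = 1 := by field_simp
    rw [this, one_smul]

/-- Take the rank-one operator on some `ρ *ᵥ v ≠ 0` and subtract its trace times `ρ`. If the result
were zero, `ρ` would be proportional to a rank-one operator, hence pure. -/
theorem exists_supp_trace_eq_zero {ρ : Matrix X X ℂ} (hρ : IsState ρ) (hp : ¬ IsPure ρ) :
    ∃ A : Matrix X X ℂ, A ≠ 0 ∧ Supp ρ A ∧ A.trace = 0 := by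
  classical
  obtain ⟨v, hv⟩ : ∃ v, ρ *ᵥ v ≠ 0 := by
    by_contra! h
    exact hρ.ne_zero (Matrix.ext_of_mulVec_single fun j => by rw [h, Matrix.zero_mulVec])
  have e : ρ * vecMulVec v (star v) * ρ = vecMulVec (ρ *ᵥ v) (star (ρ *ᵥ v)) := by
    rw [mul_vecMulVec, vecMulVec_mul, star_mulVec, hρ.1.1.eq]
  set c := (vecMulVec (ρ *ᵥ v) (star (ρ *ᵥ v))).trace with hc
  refine ⟨vecMulVec (ρ *ᵥ v) (star (ρ *ᵥ v)) - c • ρ, ?_, ?_, ?_⟩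
  · intro h
    exact hp (isPure_of_smul_eq hρ hv (sub_eq_zero.1 h).symm)
  · exact Supp.sub ⟨_, e.symm⟩ ((supp_self hρ.1.1).smul c)
  · rw [trace_sub, trace_smul, hρ.2, smul_eq_mul, mul_one, ← hc, sub_self]

end Single

set_option linter.unusedSectionVars false

/-! ### Product operators, rigidity and confinement -/

section Multi

variable {ι : Type*} [Fintype ι] [DecidableEq ι] {κ : ι → Type*}
  [∀ i, Fintype (κ i)] [∀ i, DecidableEq (κ i)]

theorem prodOp_mul (M N : ∀ i, Matrix (κ i) (κ i) ℂ) :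
    prodOp M * prodOp N = prodOp (fun i => M i * N i) := by
  ext x y
  simp only [prodOp, mul_apply, Fintype.prod_sum, Finset.prod_mul_distrib]

theorem prodOp_one : prodOp (fun i => (1 : Matrix (κ i) (κ i) ℂ)) = 1 := by
  ext x y
  by_cases h : x = y
  · subst h
    simp [prodOp]
  · obtain ⟨i, hi⟩ := Function.ne_iff.1 h
    rw [one_apply_ne h, prodOp]
    exact Finset.prod_eq_zero (Finset.mem_univ i) (one_apply_ne hi)

theorem prodOp_conjTranspose (M : ∀ i, Matrix (κ i) (κ i) ℂ) :
    (prodOp M)ᴴ = prodOp (fun i => (M i)ᴴ) := by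
  ext x y
  simp [prodOp, conjTranspose_apply]

theorem trace_prodOp (M : ∀ i, Matrix (κ i) (κ i) ℂ) : (prodOp M).trace = ∏ i, (M i).trace := by
  simp only [prodOp, trace, diag_apply, Fintype.prod_sum]

theorem prodOp_smul (c : ι → ℂ) (M : ∀ i, Matrix (κ i) (κ i) ℂ) :
    prodOp (fun i => c i • M i) = (∏ i, c i) • prodOp M := by
  ext x y
  simp [prodOp, Finset.prod_mul_distrib]

theorem prodOp_single (x y : ∀ i, κ i) :
    prodOp (fun i => single (x i) (y i) (1 : ℂ)) = single x y 1 := by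
  classical
  ext a b
  by_cases h : x = a ∧ y = b
  · obtain ⟨rfl, rfl⟩ := h
    simp [prodOp]
  · rw [single_apply, if_neg h, prodOp]
    by_cases hx : x = a
    · obtain ⟨i, hi⟩ := Function.ne_iff.1 (fun hy => h ⟨hx, hy⟩)
      exact Finset.prod_eq_zero (Finset.mem_univ i) (single_apply_of_ne _ _ _ _ _ (fun h => hi h.2))
    · obtain ⟨i, hi⟩ := Function.ne_iff.1 hx
      exact Finset.prod_eq_zero (Finset.mem_univ i) (single_apply_of_ne _ _ _ _ _ (fun h => hi h.1))

theorem prodOp_ne_zero {M : ∀ i, Matrix (κ i) (κ i) ℂ} (h : ∀ i, M i ≠ 0) : prodOp M ≠ 0 := by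
  have : ∀ i, ∃ x y, M i x y ≠ 0 := fun i => by
    by_contra! h'
    exact h i (Matrix.ext h')
  choose x y hxy using this
  intro h0
  have := congrFun (congrFun h0 x) y
  rw [prodOp, Matrix.zero_apply, Finset.prod_eq_zero_iff] at this
  obtain ⟨i, -, hi⟩ := this
  exact hxy i hi

theorem isState_prodOp {ρ : ∀ i, Matrix (κ i) (κ i) ℂ} (h : ∀ i, IsState (ρ i)) :
    IsState (prodOp ρ) := by
  constructor
  · choose B hB using fun i => exists_conjTranspose_mul_self (h i).1
    have : prodOp ρ = (prodOp B)ᴴ * prodOp B := by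
      rw [prodOp_conjTranspose, prodOp_mul]
      exact congrArg prodOp (funext hB)
    rw [this]
    exact posSemidef_conjTranspose_mul_self _
  · rw [trace_prodOp]
    exact Finset.prod_eq_one fun i _ => (h i).2

/-- Operators are determined by their expectations in product operators. -/
theorem ext_trace_mul_prodOp {A B : Matrix (∀ i, κ i) (∀ i, κ i) ℂ}
    (h : ∀ M : ∀ i, Matrix (κ i) (κ i) ℂ, (A * prodOp M).trace = (B * prodOp M).trace) :
    A = B := by
  ext x y
  have := h (fun i => single (y i) (x i) 1)
  rw [prodOp_single, trace_mul_single, trace_mul_single] at this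
  simpa using this

/-- Duality of partial trace and padding by identities; it lets marginals be handled through
expectation values only. -/
theorem trace_marginal_mul (S : Finset ι) (A : Matrix (∀ i, κ i) (∀ i, κ i) ℂ)
    (M : ∀ i, Matrix (κ i) (κ i) ℂ) :
    (marginal S A * prodOp (fun i : {i // i ∈ S} => M i)).trace =
      (A * prodOp (fun i => if i ∈ S then M i else 1)).trace := by
  have key : ∀ x y z z', prodOp (fun i => if i ∈ S then M i else 1) (glue S y z') (glue S x z) =
      prodOp (fun i : {i // i ∈ S} => M i) y x * (1 : Matrix _ _ ℂ) z' z := by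
    intro x y z z'
    rw [← prodOp_one]
    simp only [prodOp]
    rw [← Fintype.prod_subtype_mul_prod_subtype (fun i => i ∈ S)]
    congr 1
    · refine Finset.prod_congr (by ext; simp) fun i _ => ?_
      simp [glue, i.2]
    · refine Finset.prod_congr rfl fun i _ => ?_
      simp only [glue, i.2, dif_neg, if_neg, not_false_eq_true]
  have e := fun f : (∀ i, κ i) → ℂ =>
    (Equiv.piEquivPiSubtypeProd (fun i => i ∈ S) κ).symm.sum_comp f
  simp only [trace, diag_apply, mul_apply]
  rw [← e, Fintype.sum_prod_type]
  simp_rw [← e, Fintype.sum_prod_type]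
  change _ = ∑ x, ∑ z, ∑ y, ∑ z', A (glue S x z) (glue S y z') *
    prodOp (fun i => if i ∈ S then M i else 1) (glue S y z') (glue S x z)
  simp only [key, marginal]
  refine Finset.sum_congr rfl fun x _ => ?_
  rw [Finset.sum_comm]
  refine Finset.sum_congr rfl fun y _ => ?_
  rw [Finset.sum_mul]
  refine Finset.sum_congr rfl fun z _ => ?_
  simp [one_apply]

/-- All expectations of `A` in product operators acting on fewer than `w` parties vanish. -/
def Vanish (w : ℕ) (A : Matrix (∀ i, κ i) (∀ i, κ i) ℂ) : Prop :=
  ∀ (T : Finset ι) (M : ∀ i, Matrix (κ i) (κ i) ℂ), T.card < w → (∀ i ∉ T, M i = 1) →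
    (A * prodOp M).trace = 0

/-- `Vanish` bounds the number of parties strictly, hence `k + 1`. As `k ≤ Fintype.card ι`, every
smaller set of parties sits in one of size exactly `k`. -/
theorem compatible_iff {k : ℕ} (hk : k ≤ Fintype.card ι)
    {σ ρ : Matrix (∀ i, κ i) (∀ i, κ i) ℂ} : Compatible k σ ρ ↔ Vanish (k + 1) (σ - ρ) := by
  constructor
  · intro h T M hT hM
    obtain ⟨S, hTS, -, hS⟩ := Finset.exists_subsuperset_card_eq (Finset.subset_univ T)
      (Nat.lt_succ_iff.1 hT) (by simpa using hk)
    have e : M = fun i => if i ∈ S then M i else 1 := by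
      funext i
      split_ifs with hi
      · rfl
      · exact hM i fun h => hi (hTS h)
    rw [e, Matrix.sub_mul, trace_sub, ← trace_marginal_mul, ← trace_marginal_mul, h S hS, sub_self]
  · intro h S hS
    refine ext_trace_mul_prodOp fun M => ?_
    set M' : ∀ i, Matrix (κ i) (κ i) ℂ := fun i => if h : i ∈ S then M ⟨i, h⟩ else 1 with hM'
    have e : M = fun i : {i // i ∈ S} => M' i := by
      funext i
      simp [hM']
    rw [e, trace_marginal_mul, trace_marginal_mul, ← sub_eq_zero, ← trace_sub, ← Matrix.sub_mul]
    refine h S _ (by omega) fun i hi => if_neg hi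

theorem Vanish.mono {v w : ℕ} (h : v ≤ w) {A : Matrix (∀ i, κ i) (∀ i, κ i) ℂ}
    (hA : Vanish w A) : Vanish v A := fun T M hT => hA T M (hT.trans_le h)

theorem Vanish.add {w : ℕ} {A B : Matrix (∀ i, κ i) (∀ i, κ i) ℂ} (hA : Vanish w A)
    (hB : Vanish w B) : Vanish w (A + B) := fun T M hT hM => by
  rw [Matrix.add_mul, trace_add, hA T M hT hM, hB T M hT hM, add_zero]

theorem Vanish.smul {w : ℕ} {A : Matrix (∀ i, κ i) (∀ i, κ i) ℂ} (hA : Vanish w A) (c : ℂ) :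
    Vanish w (c • A) := fun T M hT hM => by
  rw [Matrix.smul_mul, trace_smul, hA T M hT hM, smul_zero]

theorem Vanish.conjTranspose {w : ℕ} {A : Matrix (∀ i, κ i) (∀ i, κ i) ℂ} (hA : Vanish w A) :
    Vanish w Aᴴ := fun T M hT hM => by
  have := hA T (fun i => (M i)ᴴ) hT fun i hi => by rw [hM i hi, conjTranspose_one]
  rw [← prodOp_conjTranspose, trace_mul_comm, ← conjTranspose_conjTranspose A,
    ← conjTranspose_mul, trace_conjTranspose, star_eq_zero] at this
  exact this

/-- An operator supported on `ρ` whose `k`-partite marginals vanish is zero. -/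
def Rigid (ρ : Matrix (∀ i, κ i) (∀ i, κ i) ℂ) (k : ℕ) : Prop :=
  ∀ A, Supp ρ A → Vanish (k + 1) A → A = 0

theorem Rigid.mono {ρ : Matrix (∀ i, κ i) (∀ i, κ i) ℂ} {k l : ℕ} (h : Rigid ρ k) (hkl : k ≤ l) :
    Rigid ρ l := fun A hA hv => h A hA (hv.mono (by omega))

/-- States with the `k`-partite marginals of `ρ` are supported on `ρ`. -/
def Confining (k : ℕ) (ρ : Matrix (∀ i, κ i) (∀ i, κ i) ℂ) : Prop :=
  ∀ σ : Matrix (∀ i, κ i) (∀ i, κ i) ℂ, σ.PosSemidef → Vanish (k + 1) (σ - ρ) → Supp ρ σ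

/-- A witness against rigidity is a direction in which the state can be moved; confinement ensures
that every competitor arises from such a direction. -/
theorem isUDA_iff_rigid {k : ℕ} (hk : k ≤ Fintype.card ι)
    {ρ : Matrix (∀ i, κ i) (∀ i, κ i) ℂ} (hρ : IsState ρ) (hc : Confining k ρ) :
    IsUDA k ρ ↔ Rigid ρ k := by
  constructor
  · intro h
    have herm : ∀ A : Matrix (∀ i, κ i) (∀ i, κ i) ℂ, A.IsHermitian → Supp ρ A →
        Vanish (k + 1) A → A = 0 := by
      intro A hA hs hv
      obtain ⟨ε, hε, hpos⟩ := exists_add_smul_posSemidef hρ.1 hA hs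
      have htr : A.trace = 0 := by
        have := hv ∅ (fun _ => 1) (by simp) (fun _ _ => rfl)
        rwa [prodOp_one, Matrix.mul_one] at this
      have := h (ρ + (ε : ℂ) • A) ⟨hpos, by rw [trace_add, trace_smul, htr, hρ.2]; simp⟩
        ((compatible_iff hk).2 (by rw [add_sub_cancel_left]; exact hv.smul _))
      rw [add_eq_left, smul_eq_zero] at this
      exact this.resolve_left (by exact_mod_cast hε.ne')
    -- Apply the Hermitian case to `A + Aᴴ` and to `i A + (i A)ᴴ`; together they give `A = 0`.
    intro A hs hv
    have h1 := herm (A + Aᴴ) (isHermitian_add_transpose_self A)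
      (hs.add (hs.conjTranspose hρ.1.1)) (hv.add hv.conjTranspose)
    have h2 := herm (Complex.I • A + (Complex.I • A)ᴴ) (isHermitian_add_transpose_self _)
      ((hs.smul _).add ((hs.smul _).conjTranspose hρ.1.1))
      ((hv.smul _).add (hv.smul _).conjTranspose)
    have h3 : Aᴴ = -A := by rwa [← add_eq_zero_iff_eq_neg']
    rw [conjTranspose_smul, h3, Complex.star_def, Complex.conj_I, neg_smul_neg, ← two_smul ℂ,
      smul_smul, smul_eq_zero] at h2
    exact h2.resolve_left (by simp)
  · intro h σ hσ hcomp
    have hv := (compatible_iff hk).1 hcomp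
    exact sub_eq_zero.1 (h _ ((hc σ hσ.1 hv).sub (supp_self hρ.1.1)) hv)

/-- For `k = 0` only the trace is tested, and the range of a pure state carries only multiples of
that state. -/
theorem rigid_zero_iff {ρ : Matrix (∀ i, κ i) (∀ i, κ i) ℂ} (hρ : IsState ρ) :
    Rigid ρ 0 ↔ IsPure ρ := by
  constructor
  · intro h
    by_contra hp
    obtain ⟨A, hA, hs, ht⟩ := exists_supp_trace_eq_zero hρ hp
    refine hA (h A hs fun T M hT hM => ?_)
    have : M = fun _ => 1 := by
      funext i
      exact hM i (by simp_all)
    rw [this, prodOp_one, Matrix.mul_one, ht]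
  · rintro hp A ⟨Z, rfl⟩ hv
    have := hv ∅ (fun _ => 1) (by simp) (fun _ _ => rfl)
    rw [prodOp_one, Matrix.mul_one, hp.mul_mul, trace_smul, hρ.2, smul_eq_mul, mul_one] at this
    rw [hp.mul_mul, this, zero_smul]

/-- `ρ` is rigid precisely from `w` on. -/
def HasWeight (ρ : Matrix (∀ i, κ i) (∀ i, κ i) ℂ) (w : ℕ) : Prop :=
  ∀ k, Rigid ρ k ↔ w ≤ k

theorem HasWeight.exists_vanish {ρ : Matrix (∀ i, κ i) (∀ i, κ i) ℂ} {w : ℕ}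
    (h : HasWeight ρ w) (hρ : IsState ρ) : ∃ A, A ≠ 0 ∧ Supp ρ A ∧ Vanish w A := by
  -- In weight 0 nothing has to vanish, so `ρ` itself serves.
  obtain _ | w := w
  · exact ⟨ρ, hρ.ne_zero, supp_self hρ.1.1, fun T M hT => absurd hT (Nat.not_lt_zero _)⟩
  · have : ¬ Rigid ρ w := fun h' => by
      have := (h w).1 h'
      omega
    simp only [Rigid, not_forall] at this
    obtain ⟨A, hs, hv, hA⟩ := this
    exact ⟨A, hA, hs, hv⟩

open scoped Classical in
-- A traceless supported operator at each mixed site, tensored with the pure factors, is invisible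
-- unless every mixed site is touched. Conversely, at pure sites any observable acts as a scalar, so
-- expectations on the mixed sites determine a supported operator.
theorem hasWeight_prodOp {ρ : ∀ i, Matrix (κ i) (κ i) ℂ} (hρ : ∀ i, IsState (ρ i)) :
    HasWeight (prodOp ρ) (Finset.univ.filter fun i => ¬ IsPure (ρ i)).card := by
  intro k
  constructor
  · intro h
    by_contra! hk
    choose! A hA hs ht using fun i (hi : ¬ IsPure (ρ i)) => exists_supp_trace_eq_zero (hρ i) hi
    set B : ∀ i, Matrix (κ i) (κ i) ℂ := fun i => if IsPure (ρ i) then ρ i else A i with hB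
    have hBne : ∀ i, B i ≠ 0 := fun i => by
      by_cases hi : IsPure (ρ i)
      · simpa [hB, hi] using (hρ i).ne_zero
      · simpa [hB, hi] using hA i hi
    have hBs : ∀ i, Supp (ρ i) (B i) := fun i => by
      by_cases hi : IsPure (ρ i)
      · simpa [hB, hi] using supp_self (hρ i).1.1
      · simpa [hB, hi] using hs i hi
    choose Z hZ using hBs
    refine prodOp_ne_zero hBne (h _ ⟨prodOp Z, ?_⟩ fun T M hT hM => ?_)
    · rw [prodOp_mul, prodOp_mul]
      exact congrArg prodOp (funext hZ)
    · obtain ⟨i, hi, hiT⟩ : ∃ i ∈ Finset.univ.filter fun i => ¬ IsPure (ρ i), i ∉ T := by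
        by_contra! h'
        have := Finset.card_le_card h'
        omega
      have hi' : ¬ IsPure (ρ i) := by simpa using hi
      rw [prodOp_mul, trace_prodOp]
      refine Finset.prod_eq_zero (Finset.mem_univ i) ?_
      rw [hM i hiT, Matrix.mul_one]
      simpa [hB, hi'] using ht i hi'
  · rintro hk A ⟨Z, rfl⟩ hv
    refine ext_trace_mul_prodOp fun M => ?_
    set T := Finset.univ.filter fun i => ¬ IsPure (ρ i) with hT
    have hv' := hv T (fun i => if i ∈ T then M i else 1) (by omega) (fun i hi => if_neg hi)
    have cyc : ∀ N : ∀ i, Matrix (κ i) (κ i) ℂ, (prodOp ρ * Z * prodOp ρ * prodOp N).trace =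
        (Z * prodOp (fun i => ρ i * N i * ρ i)).trace := fun N => by
      rw [← prodOp_mul, ← prodOp_mul, Matrix.mul_assoc, Matrix.mul_assoc, trace_mul_comm]
      simp only [Matrix.mul_assoc]
    rw [cyc] at hv'
    rw [cyc, Matrix.zero_mul, trace_zero]
    have e : prodOp (fun i => ρ i * M i * ρ i) =
        (∏ i, if i ∈ T then 1 else (ρ i * M i).trace) •
          prodOp (fun i => ρ i * (if i ∈ T then M i else 1) * ρ i) := by
      rw [← prodOp_smul]
      congr 1
      funext i
      by_cases hi : i ∈ T
      · simp [hi]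
      · have hp : IsPure (ρ i) := by simpa [hT] using hi
        simp only [hi, if_false]
        rw [hp.mul_mul, hp.mul_mul, Matrix.mul_one, (hρ i).2, one_smul]
    rw [e, Matrix.mul_smul, trace_smul, hv', smul_zero]

theorem prodOp_update_one_mul (i : ι) (A B : Matrix (κ i) (κ i) ℂ) :
    prodOp (Function.update (fun _ => 1) i A) * prodOp (Function.update (fun _ => 1) i B) =
      prodOp (Function.update (fun _ => 1) i (A * B)) := by
  rw [prodOp_mul]
  congr 1
  funext j
  by_cases h : j = i
  · subst h; simp
  · simp [h]

theorem prodOp_update_one_conjTranspose (i : ι) (A : Matrix (κ i) (κ i) ℂ) :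
    (prodOp (Function.update (fun _ => 1) i A))ᴴ = prodOp (Function.update (fun _ => 1) i Aᴴ) := by
  rw [prodOp_conjTranspose]
  congr 1
  funext j
  by_cases h : j = i
  · subst h; simp
  · simp [h]

/-- The 1-marginals give zero expectation to `(1 - g * ρ i) * (1 - g * ρ i)ᴴ` at each site, so `σ`
absorbs `g i * ρ i` everywhere and factors through the product. -/
theorem confining_prodOp {k : ℕ} (hk : 1 ≤ k) {ρ : ∀ i, Matrix (κ i) (κ i) ℂ}
    (hρ : ∀ i, IsState (ρ i)) : Confining k (prodOp ρ) := by
  intro σ hσ hv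
  choose g hg using fun i => exists_mul_mul_self (hρ i).1.1
  have hsite : ∀ i, σ * prodOp (Function.update (fun _ => 1) i (g i * ρ i)) = σ := by
    intro i
    have h0 : σ * prodOp (Function.update (fun _ => 1) i (1 - g i * ρ i)) = 0 := by
      refine mul_eq_zero_of_trace_mul_eq_zero hσ ?_
      rw [prodOp_update_one_conjTranspose, prodOp_update_one_mul]
      have h1 := hv {i} (Function.update (fun _ => 1) i
        ((1 - g i * ρ i) * (1 - g i * ρ i)ᴴ)) (by simp; omega) (fun j hj => by
          rw [Function.update_of_ne (by simpa using hj)])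
      rw [Matrix.sub_mul, trace_sub, sub_eq_zero] at h1
      rw [h1, prodOp_mul, trace_prodOp]
      refine Finset.prod_eq_zero (Finset.mem_univ i) ?_
      rw [Function.update_self, ← Matrix.mul_assoc, Matrix.mul_sub, ← Matrix.mul_assoc, hg,
        Matrix.mul_one, sub_self, Matrix.zero_mul, trace_zero]
    have h2 : prodOp (Function.update (fun _ => 1) i (1 - g i * ρ i)) =
        1 - prodOp (Function.update (fun _ => 1) i (g i * ρ i)) := by
      rw [← prodOp_one]
      ext x y
      simp only [prodOp, Matrix.sub_apply]
      rw [← Finset.mul_prod_erase _ _ (Finset.mem_univ i),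
        ← Finset.mul_prod_erase _ _ (Finset.mem_univ i),
        ← Finset.mul_prod_erase _ _ (Finset.mem_univ i)]
      have : ∀ A : Matrix (κ i) (κ i) ℂ, ∏ j ∈ Finset.univ.erase i,
          (Function.update (fun j => (1 : Matrix (κ j) (κ j) ℂ)) i A) j (x j) (y j) =
          ∏ j ∈ Finset.univ.erase i, (1 : Matrix (κ j) (κ j) ℂ) (x j) (y j) := fun A =>
        Finset.prod_congr rfl fun j hj => by
          rw [Function.update_of_ne (Finset.ne_of_mem_erase hj)]
      rw [this, this, Function.update_self, Function.update_self, Matrix.sub_apply, sub_mul]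
    rw [h2, Matrix.mul_sub, Matrix.mul_one, sub_eq_zero] at h0
    exact h0.symm
  have hall : ∀ S : Finset ι, σ * prodOp (fun i => if i ∈ S then g i * ρ i else 1) = σ := by
    intro S
    induction S using Finset.induction_on with
    | empty => simp [prodOp_one]
    | insert i S hi ih =>
      conv_rhs => rw [← ih, ← hsite i]
      rw [Matrix.mul_assoc, prodOp_mul]
      congr 2
      funext j
      by_cases h : j = i
      · subst h; simp [hi]
      · simp [h]
  have h := hall Finset.univ
  simp only [Finset.mem_univ, if_true] at h
  refine supp_of_eq_mul (Y := σ * prodOp g) (isState_prodOp hρ).1.1 hσ.1 ?_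
  rw [Matrix.mul_assoc, prodOp_mul, h]

end Multi

/-! ### Tensor products: partial contractions and additivity of weight -/

section Tensor

open scoped Kronecker

variable {m l : ℕ}

theorem tensor_eq_submatrix (α : QubitOp m) (β : QubitOp l) :
    tensor α β = (α ⊗ₖ β).submatrix (Fin.appendEquiv m l).symm (Fin.appendEquiv m l).symm := rfl

theorem tensor_mul (α γ : QubitOp m) (β δ : QubitOp l) :
    tensor α β * tensor γ δ = tensor (α * γ) (β * δ) := by
  simp only [tensor_eq_submatrix, submatrix_mul_equiv, mul_kronecker_mul]

theorem tensor_one : tensor (1 : QubitOp m) (1 : QubitOp l) = 1 := by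
  rw [tensor_eq_submatrix, one_kronecker_one, submatrix_one_equiv]

theorem tensor_conjTranspose (α : QubitOp m) (β : QubitOp l) :
    (tensor α β)ᴴ = tensor αᴴ βᴴ := by
  rw [tensor_eq_submatrix, conjTranspose_submatrix, conjTranspose_kronecker]
  rfl

theorem trace_tensor (α : QubitOp m) (β : QubitOp l) :
    (tensor α β).trace = α.trace * β.trace := by
  rw [← trace_kronecker]
  exact (Fin.appendEquiv m l).symm.sum_comp fun p => (α ⊗ₖ β) p p

theorem tensor_sub_left (α γ : QubitOp m) (β : QubitOp l) :
    tensor (α - γ) β = tensor α β - tensor γ β := by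
  ext x y
  simp [tensor, sub_mul]

theorem tensor_sub_right (α : QubitOp m) (β γ : QubitOp l) :
    tensor α (β - γ) = tensor α β - tensor α γ := by
  ext x y
  simp [tensor, mul_sub]

theorem tensor_append (α : QubitOp m) (β : QubitOp l) (x y : Fin m → Fin 2) (u v : Fin l → Fin 2) :
    tensor α β (Fin.append x u) (Fin.append y v) = α x y * β u v := by
  simp [tensor]

theorem tensor_ne_zero {α : QubitOp m} {β : QubitOp l} (hα : α ≠ 0) (hβ : β ≠ 0) :
    tensor α β ≠ 0 := by
  intro h
  obtain ⟨x, y, hxy⟩ : ∃ x y, α x y ≠ 0 := by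
    by_contra! h'
    exact hα (Matrix.ext h')
  obtain ⟨u, v, huv⟩ : ∃ u v, β u v ≠ 0 := by
    by_contra! h'
    exact hβ (Matrix.ext h')
  refine mul_ne_zero hxy huv ?_
  rw [← tensor_append, h, Matrix.zero_apply]

theorem prodOp_eq_tensor (M : Fin (m + l) → Matrix (Fin 2) (Fin 2) ℂ) :
    prodOp M = tensor (prodOp fun i => M (Fin.castAdd l i)) (prodOp fun j => M (Fin.natAdd m j)) := by
  ext x y
  simp only [prodOp, tensor, Fin.prod_univ_add]

theorem prodOp_append (M : Fin m → Matrix (Fin 2) (Fin 2) ℂ) (N : Fin l → Matrix (Fin 2) (Fin 2) ℂ) :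
    prodOp (Fin.append M N) = tensor (prodOp M) (prodOp N) := by
  rw [prodOp_eq_tensor]
  simp only [Fin.append_left, Fin.append_right]

theorem IsState.tensor {α : QubitOp m} {β : QubitOp l} (hα : IsState α) (hβ : IsState β) :
    IsState (tensor α β) := by
  constructor
  · obtain ⟨A, rfl⟩ := exists_conjTranspose_mul_self hα.1
    obtain ⟨B, rfl⟩ := exists_conjTranspose_mul_self hβ.1
    rw [← tensor_mul, ← tensor_conjTranspose]
    exact posSemidef_conjTranspose_mul_self _
  · rw [trace_tensor, hα.2, hβ.2, one_mul]

/-- The partial trace of `A (1 ⊗ E)` over the last `l` qubits. -/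
def contractRight (A : QubitOp (m + l)) (E : QubitOp l) : QubitOp m :=
  fun x y => ∑ u, ∑ v, A (Fin.append x u) (Fin.append y v) * E v u

/-- The partial trace of `A (E ⊗ 1)` over the first `m` qubits. -/
def contractLeft (A : QubitOp (m + l)) (E : QubitOp m) : QubitOp l :=
  fun u v => ∑ x, ∑ y, A (Fin.append x u) (Fin.append y v) * E y x

theorem trace_mul_tensor (A : QubitOp (m + l)) (B : QubitOp m) (E : QubitOp l) :
    (A * tensor B E).trace = ∑ x, ∑ u, ∑ y, ∑ v,
      A (Fin.append x u) (Fin.append y v) * (B y x * E v u) := by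
  have e : ∀ f : (Fin (m + l) → Fin 2) → ℂ, ∑ p, f p = ∑ x, ∑ u, f (Fin.append x u) := fun f => by
    rw [← (Fin.appendEquiv m l).sum_comp f, Fintype.sum_prod_type]
    rfl
  simp only [trace, diag_apply, mul_apply, e, tensor_append]

theorem trace_contractRight_mul (A : QubitOp (m + l)) (B : QubitOp m) (E : QubitOp l) :
    (contractRight A E * B).trace = (A * tensor B E).trace := by
  rw [trace_mul_tensor]
  simp only [trace, diag_apply, mul_apply, contractRight, Finset.sum_mul]
  refine Finset.sum_congr rfl fun x _ => ?_
  rw [Finset.sum_comm]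
  refine Finset.sum_congr rfl fun u _ => Finset.sum_congr rfl fun y _ =>
    Finset.sum_congr rfl fun v _ => by ring

theorem trace_contractLeft_mul (A : QubitOp (m + l)) (B : QubitOp m) (E : QubitOp l) :
    (contractLeft A B * E).trace = (A * tensor B E).trace := by
  rw [trace_mul_tensor]
  simp only [trace, diag_apply, mul_apply, contractLeft, Finset.sum_mul]
  rw [Finset.sum_comm (s := (Finset.univ : Finset (Fin m → Fin 2)))]
  refine Finset.sum_congr rfl fun u _ => ?_
  rw [Finset.sum_comm]
  refine Finset.sum_congr rfl fun x _ => ?_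
  rw [Finset.sum_comm]
  refine Finset.sum_congr rfl fun y _ => Finset.sum_congr rfl fun v _ => by ring

theorem contractRight_mul_mul (α : QubitOp m) (β : QubitOp l) (Z : QubitOp (m + l))
    (E : QubitOp l) : contractRight (tensor α β * Z * tensor α β) E =
      α * contractRight Z (β * E * β) * α := by
  rw [ext_iff_trace_mul_right]
  intro B
  rw [trace_contractRight_mul, Matrix.mul_assoc, Matrix.mul_assoc, trace_mul_comm,
    Matrix.mul_assoc, tensor_mul, Matrix.mul_assoc, tensor_mul, ← trace_contractRight_mul,
    Matrix.mul_assoc α, Matrix.mul_assoc α, trace_mul_comm α]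
  simp only [Matrix.mul_assoc]

theorem contractLeft_mul_mul (α : QubitOp m) (β : QubitOp l) (Z : QubitOp (m + l))
    (E : QubitOp m) : contractLeft (tensor α β * Z * tensor α β) E =
      β * contractLeft Z (α * E * α) * β := by
  rw [ext_iff_trace_mul_right]
  intro B
  rw [trace_contractLeft_mul, Matrix.mul_assoc, Matrix.mul_assoc, trace_mul_comm,
    Matrix.mul_assoc, tensor_mul, Matrix.mul_assoc, tensor_mul, ← trace_contractLeft_mul,
    Matrix.mul_assoc β, Matrix.mul_assoc β, trace_mul_comm β]
  simp only [Matrix.mul_assoc]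

theorem contractRight_tensor (α : QubitOp m) (β E : QubitOp l) :
    contractRight (tensor α β) E = (β * E).trace • α := by
  rw [ext_iff_trace_mul_right]
  intro B
  rw [trace_contractRight_mul, tensor_mul, trace_tensor, smul_mul, trace_smul, smul_eq_mul,
    mul_comm]

theorem contractLeft_tensor (α E : QubitOp m) (β : QubitOp l) :
    contractLeft (tensor α β) E = (α * E).trace • β := by
  rw [ext_iff_trace_mul_right]
  intro B
  rw [trace_contractLeft_mul, tensor_mul, trace_tensor, smul_mul, trace_smul, smul_eq_mul]

theorem contractRight_posSemidef {σ : QubitOp (m + l)} (hσ : σ.PosSemidef) :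
    (contractRight σ 1).PosSemidef := by
  have : contractRight σ 1 = ∑ u : Fin l → Fin 2,
      σ.submatrix (fun x => Fin.append x u) (fun x => Fin.append x u) := by
    ext x y
    simp [contractRight, Matrix.sum_apply, one_apply]
  rw [this]
  exact posSemidef_sum _ fun u _ => hσ.submatrix _

theorem contractLeft_posSemidef {σ : QubitOp (m + l)} (hσ : σ.PosSemidef) :
    (contractLeft σ 1).PosSemidef := by
  have : contractLeft σ 1 = ∑ x : Fin m → Fin 2,
      σ.submatrix (fun u => Fin.append x u) (fun u => Fin.append x u) := by
    ext x y
    simp [contractLeft, Matrix.sum_apply, one_apply]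
  rw [this]
  exact posSemidef_sum _ fun u _ => hσ.submatrix _

theorem Vanish.trace_mul_tensor {w : ℕ} {A : QubitOp (m + l)} (hA : Vanish w A)
    {S : Finset (Fin m)} {T : Finset (Fin l)} (h : S.card + T.card < w)
    {M : Fin m → Matrix (Fin 2) (Fin 2) ℂ} {N : Fin l → Matrix (Fin 2) (Fin 2) ℂ}
    (hM : ∀ i ∉ S, M i = 1) (hN : ∀ j ∉ T, N j = 1) :
    (A * tensor (prodOp M) (prodOp N)).trace = 0 := by
  rw [← prodOp_append]
  refine hA (S.map (Fin.castAddEmb l) ∪ T.map (Fin.natAddEmb m)) _ ?_ fun i hi => ?_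
  · refine (Finset.card_union_le _ _).trans_lt ?_
    rwa [Finset.card_map, Finset.card_map]
  · induction i using Fin.addCases with
    | left i =>
      rw [Fin.append_left]
      refine hM i fun h => hi (Finset.mem_union_left _ ?_)
      exact Finset.mem_map_of_mem (Fin.castAddEmb l) h
    | right j =>
      rw [Fin.append_right]
      refine hN j fun h => hi (Finset.mem_union_right _ ?_)
      exact Finset.mem_map_of_mem (Fin.natAddEmb m) h

theorem Vanish.tensor {a b : ℕ} {A : QubitOp m} {B : QubitOp l} (hA : Vanish a A)
    (hB : Vanish b B) : Vanish (a + b) (tensor A B) := by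
  intro T M hT hM
  set T₁ := Finset.univ.filter fun i : Fin m => Fin.castAdd l i ∈ T
  set T₂ := Finset.univ.filter fun j : Fin l => Fin.natAdd m j ∈ T
  have hcard : T₁.card + T₂.card ≤ T.card := by
    rw [← Finset.card_map (Fin.castAddEmb l), ← Finset.card_map (s := T₂) (Fin.natAddEmb m),
      ← Finset.card_union_of_disjoint]
    · refine Finset.card_le_card fun i hi => ?_
      simp only [Finset.mem_union, Finset.mem_map, T₁, T₂, Finset.mem_filter] at hi
      obtain ⟨j, hj, rfl⟩ | ⟨j, hj, rfl⟩ := hi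
      · exact hj.2
      · exact hj.2
    · rw [Finset.disjoint_left]
      intro i hi hi'
      simp only [Finset.mem_map] at hi hi'
      obtain ⟨j, -, rfl⟩ := hi
      obtain ⟨j', -, h⟩ := hi'
      have := congrArg Fin.val h
      simp at this
      omega
  rw [prodOp_eq_tensor, tensor_mul, trace_tensor]
  by_cases h : T₁.card < a
  · rw [hA T₁ _ h fun i hi => hM _ (by simpa [T₁] using hi), zero_mul]
  · rw [hB T₂ _ (by omega) fun i hi => hM _ (by simpa [T₂] using hi), mul_zero]

theorem Supp.tensor {α A : QubitOp m} {β B : QubitOp l} (hA : Supp α A) (hB : Supp β B) :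
    Supp (tensor α β) (tensor A B) := by
  obtain ⟨Y, rfl⟩ := hA
  obtain ⟨Z, rfl⟩ := hB
  exact ⟨QuantumMarginal.tensor Y Z, by rw [tensor_mul, tensor_mul]⟩

theorem Rigid.tensor {a b : ℕ} {α : QubitOp m} {β : QubitOp l} (hα : Rigid α a)
    (hβ : Rigid β b) : Rigid (tensor α β) (a + b) := by
  rintro A ⟨Z, hZ⟩ hv
  -- Contracting against at most `b` parties on the right leaves an operator on the range of `α`
  -- that vanishes on at most `a` parties, so rigidity of `α` applies.
  have h1 : ∀ (T : Finset (Fin l)) (N : Fin l → Matrix (Fin 2) (Fin 2) ℂ), T.card < b + 1 →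
      (∀ j ∉ T, N j = 1) → contractRight A (prodOp N) = 0 := by
    intro T N hT hN
    refine hα _ ⟨_, by rw [hZ, contractRight_mul_mul]⟩ fun S M hS hM => ?_
    rw [trace_contractRight_mul]
    exact hv.trace_mul_tensor (by omega) hM hN
  have h2 : ∀ B : QubitOp m, contractLeft A B = 0 := by
    intro B
    refine hβ _ ⟨_, by rw [hZ, contractLeft_mul_mul]⟩ fun T N hT hN => ?_
    rw [trace_contractLeft_mul, ← trace_contractRight_mul, h1 T N hT hN, Matrix.zero_mul,
      trace_zero]
  refine ext_trace_mul_prodOp fun M => ?_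
  rw [prodOp_eq_tensor, ← trace_contractLeft_mul, h2]
  simp

theorem HasWeight.tensor {a b : ℕ} {α : QubitOp m} {β : QubitOp l} (hα : HasWeight α a)
    (hβ : HasWeight β b) (hα' : IsState α) (hβ' : IsState β) :
    HasWeight (tensor α β) (a + b) := by
  intro k
  constructor
  · intro h
    by_contra! hk
    obtain ⟨A, hA, hAs, hAv⟩ := hα.exists_vanish hα'
    obtain ⟨B, hB, hBs, hBv⟩ := hβ.exists_vanish hβ'
    exact tensor_ne_zero hA hB (h _ (hAs.tensor hBs) ((hAv.tensor hBv).mono hk))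
  · exact fun h => (((hα a).2 le_rfl).tensor ((hβ b).2 le_rfl)).mono h

/-- The partial traces of `σ` share the marginals of `α` and `β`, so each is confined; the support
of `σ` is then confined on each side separately. -/
theorem Confining.tensor {k : ℕ} {α : QubitOp m} {β : QubitOp l} (hα : Confining k α)
    (hβ : Confining k β) (hα' : IsState α) (hβ' : IsState β) : Confining k (tensor α β) := by
  intro σ hσ hv
  obtain ⟨g, hg⟩ := exists_mul_mul_self hα'.1.1
  obtain ⟨h, hh⟩ := exists_mul_mul_self hβ'.1.1
  have h1 : Supp α (contractRight σ 1) := by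
    refine hα _ (contractRight_posSemidef hσ) fun S M hS hM => ?_
    have := hv.trace_mul_tensor (S := S) (T := ∅) (by simpa using hS) hM (N := fun _ => 1)
      fun _ _ => rfl
    rw [Matrix.sub_mul, trace_sub, prodOp_one] at this
    rw [Matrix.sub_mul, trace_sub, trace_contractRight_mul, ← this, tensor_mul, trace_tensor,
      Matrix.mul_one, hβ'.2, mul_one]
  have h2 : Supp β (contractLeft σ 1) := by
    refine hβ _ (contractLeft_posSemidef hσ) fun S M hS hM => ?_
    have := hv.trace_mul_tensor (S := ∅) (T := S) (by simpa using hS) (M := fun _ => 1)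
      (fun _ _ => rfl) hM
    rw [Matrix.sub_mul, trace_sub, prodOp_one] at this
    rw [Matrix.sub_mul, trace_sub, trace_contractLeft_mul, ← this, tensor_mul, trace_tensor,
      Matrix.mul_one, hα'.2, one_mul]
  have e1 : σ * QuantumMarginal.tensor (g * α) 1 = σ := by
    have h0 : σ * QuantumMarginal.tensor (1 - g * α) 1 = 0 := by
      refine mul_eq_zero_of_trace_mul_eq_zero hσ ?_
      obtain ⟨Z, hZ⟩ := h1
      rw [tensor_conjTranspose, tensor_mul, conjTranspose_one, Matrix.mul_one,
        ← trace_contractRight_mul, hZ, ← Matrix.mul_assoc, Matrix.mul_sub, Matrix.mul_one,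
        Matrix.mul_assoc _ α (g * α), ← Matrix.mul_assoc α g α, hg, sub_self, Matrix.zero_mul,
        trace_zero]
    rw [tensor_sub_left, Matrix.mul_sub, tensor_one, Matrix.mul_one, sub_eq_zero] at h0
    exact h0.symm
  have e2 : σ * QuantumMarginal.tensor 1 (h * β) = σ := by
    have h0 : σ * QuantumMarginal.tensor 1 (1 - h * β) = 0 := by
      refine mul_eq_zero_of_trace_mul_eq_zero hσ ?_
      obtain ⟨Z, hZ⟩ := h2
      rw [tensor_conjTranspose, tensor_mul, conjTranspose_one, Matrix.mul_one,
        ← trace_contractLeft_mul, hZ, ← Matrix.mul_assoc, Matrix.mul_sub, Matrix.mul_one,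
        Matrix.mul_assoc _ β (h * β), ← Matrix.mul_assoc β h β, hh, sub_self, Matrix.zero_mul,
        trace_zero]
    rw [tensor_sub_right, Matrix.mul_sub, tensor_one, Matrix.mul_one, sub_eq_zero] at h0
    exact h0.symm
  refine supp_of_eq_mul (Y := σ * QuantumMarginal.tensor g h) (hα'.tensor hβ').1.1 hσ.1 ?_
  conv_lhs => rw [← e2, ← e1]
  rw [Matrix.mul_assoc, tensor_mul, Matrix.mul_assoc σ, tensor_mul, Matrix.one_mul, Matrix.mul_one]

end Tensor

/-! ### Existence of weights; 1-marginals of product states -/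

/-- An `n`-qubit state with `n ≤ k` is confining. -/
theorem confining_of_card_le {n k : ℕ} (h : n ≤ k) {ρ : QubitOp n} (hρ : IsState ρ) :
    Confining k ρ := by
  intro σ _ hv
  have : σ - ρ = 0 := ext_trace_mul_prodOp fun M => by
    rw [Matrix.zero_mul, trace_zero]
    exact hv Finset.univ M (by simpa using Nat.lt_succ_of_le h) (by simp)
  rw [sub_eq_zero.1 this]
  exact supp_self hρ.1.1

theorem rigid_of_card_le {n k : ℕ} (h : n ≤ k) (ρ : QubitOp n) : Rigid ρ k := by
  intro A _ hv
  refine ext_trace_mul_prodOp fun M => ?_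
  rw [Matrix.zero_mul, trace_zero]
  exact hv Finset.univ M (by simpa using Nat.lt_succ_of_le h) (by simp)

theorem exists_hasWeight {n : ℕ} (ρ : QubitOp n) : ∃ w, HasWeight ρ w := by
  classical
  have h : ∃ k, Rigid ρ k := ⟨n, rigid_of_card_le le_rfl ρ⟩
  exact ⟨Nat.find h, fun k => ⟨fun hk => Nat.find_min' h hk, fun hk => (Nat.find_spec h).mono hk⟩⟩

theorem isPure_submatrix_equiv {X Y : Type*} [Fintype X] [Fintype Y] (e : Y ≃ X)
    (A : Matrix X X ℂ) : IsPure (A.submatrix e e) ↔ IsPure A := by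
  constructor
  · rintro ⟨ψ, h1, h2⟩
    refine ⟨ψ ∘ e.symm, ?_, ?_⟩
    · rw [← h1]
      exact e.symm.sum_comp fun y => star ψ y * ψ y
    · ext x y
      have := congrFun (congrFun h2 (e.symm x)) (e.symm y)
      simpa [vecMulVec_apply] using this
  · rintro ⟨ψ, h1, rfl⟩
    refine ⟨ψ ∘ e, ?_, rfl⟩
    rw [← h1]
    exact e.sum_comp fun y => star ψ y * ψ y

section Multi

variable {ι : Type*} [Fintype ι] [DecidableEq ι] {κ : ι → Type*}

/-- Configurations of a single party. -/
def siteEquiv (κ : ι → Type*) (i : ι) : (∀ j : {j // j ∈ ({i} : Finset ι)}, κ j) ≃ κ i where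
  toFun x := x ⟨i, Finset.mem_singleton_self i⟩
  invFun a j := (Finset.mem_singleton.1 j.2).symm ▸ a
  left_inv x := by
    funext ⟨j, hj⟩
    obtain rfl := Finset.mem_singleton.1 hj
    rfl
  right_inv a := rfl

variable [∀ i, Fintype (κ i)] [∀ i, DecidableEq (κ i)]

theorem marginal_singleton_prodOp {ρ : ∀ i, Matrix (κ i) (κ i) ℂ} (hρ : ∀ i, IsState (ρ i))
    (i : ι) : marginal {i} (prodOp ρ) = (ρ i).submatrix (siteEquiv κ i) (siteEquiv κ i) := by
  refine ext_trace_mul_prodOp fun M => ?_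
  set M' : ∀ j, Matrix (κ j) (κ j) ℂ :=
    fun j => if h : j ∈ ({i} : Finset ι) then M ⟨j, h⟩ else 1 with hM'
  have e : M = fun j : {j // j ∈ ({i} : Finset ι)} => M' j := by
    funext j
    simp only [hM', j.2, dif_pos]
  have e2 : prodOp (fun j : {j // j ∈ ({i} : Finset ι)} => M' j) =
      (M' i).submatrix (siteEquiv κ i) (siteEquiv κ i) := by
    ext x y
    simp only [prodOp, submatrix_apply]
    rw [Fintype.prod_eq_single ⟨i, Finset.mem_singleton_self i⟩]
    · rfl
    · rintro ⟨j, hj⟩ hne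
      exact absurd (Subtype.ext (Finset.mem_singleton.1 hj)) hne
  rw [e, trace_marginal_mul, prodOp_mul, trace_prodOp, e2, submatrix_mul_equiv,
    Fintype.prod_eq_single i]
  · rw [if_pos (Finset.mem_singleton_self i)]
    exact ((siteEquiv κ i).sum_comp fun a => (ρ i * M' i) a a).symm
  · intro j hj
    rw [if_neg (by simpa using hj), Matrix.mul_one, (hρ j).2]

theorem isPure_marginal_prodOp_iff {ρ : ∀ i, Matrix (κ i) (κ i) ℂ} (hρ : ∀ i, IsState (ρ i))
    (i : ι) : IsPure (marginal {i} (prodOp ρ)) ↔ IsPure (ρ i) := by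
  rw [marginal_singleton_prodOp hρ, isPure_submatrix_equiv]

open scoped Classical in
/-- The number of mixed factors. -/
noncomputable def mixedCount (ρ : ∀ i, Matrix (κ i) (κ i) ℂ) : ℕ :=
  (Finset.univ.filter fun i => ¬ IsPure (ρ i)).card

theorem allButPure_prodOp_iff {ρ : ∀ i, Matrix (κ i) (κ i) ℂ} (hρ : ∀ i, IsState (ρ i)) (k : ℕ) :
    AllButPure k (prodOp ρ) ↔ mixedCount ρ ≤ k := by
  classical
  have h : pureCount (prodOp ρ) = (Finset.univ.filter fun i => IsPure (ρ i)).card := by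
    rw [pureCount, ← Set.ncard_coe_finset]
    congr 1
    ext i
    simp [isPure_marginal_prodOp_iff hρ]
  have h2 := Finset.card_filter_add_card_filter_not (s := (Finset.univ : Finset ι))
    (fun i => IsPure (ρ i))
  rw [Finset.card_univ] at h2
  rw [AllButPure, h, mixedCount]
  constructor <;> intro h3
  · convert! (by omega : (Finset.univ.filter fun i => ¬ IsPure (ρ i)).card ≤ k)
  · have h4 : (Finset.univ.filter fun i => ¬ IsPure (ρ i)).card ≤ k := by convert! h3
    omega

theorem isUDA_prodOp_iff {k : ℕ} (hk : 1 ≤ k) (hk' : k ≤ Fintype.card ι)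
    {ρ : ∀ i, Matrix (κ i) (κ i) ℂ} (hρ : ∀ i, IsState (ρ i)) :
    IsUDA k (prodOp ρ) ↔ AllButPure k (prodOp ρ) := by
  rw [isUDA_iff_rigid hk' (isState_prodOp hρ) (confining_prodOp hk hρ), hasWeight_prodOp hρ,
    allButPure_prodOp_iff hρ]
  rfl

end Multi

/-! ### Qubit marginals; a pure marginal splits off -/

section Qubits

variable {n : ℕ}

theorem qubitMarginal_eq (ρ : QubitOp n) (i : Fin n) :
    qubitMarginal ρ i = (marginal {i} ρ).submatrix (siteEquiv (fun _ => Fin 2) i).symm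
      (siteEquiv (fun _ => Fin 2) i).symm := by
  ext a b
  have : ∀ c : Fin 2, (siteEquiv (fun _ : Fin n => Fin 2) i).symm c = fun _ => c := fun c => by
    funext ⟨j, hj⟩
    obtain rfl := Finset.mem_singleton.1 hj
    rfl
  rw [submatrix_apply, this, this]
  rfl

theorem trace_qubitMarginal_mul (ρ : QubitOp n) (i : Fin n) (E : Matrix (Fin 2) (Fin 2) ℂ) :
    (qubitMarginal ρ i * E).trace = (ρ * prodOp (Function.update (fun _ => 1) i E)).trace := by
  have h := trace_marginal_mul {i} ρ (fun _ => E)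
  have e : (fun j => if j ∈ ({i} : Finset (Fin n)) then E else 1) =
      Function.update (fun _ => (1 : Matrix (Fin 2) (Fin 2) ℂ)) i E := by
    funext j
    by_cases hj : j = i
    · subst hj; simp
    · simp [hj]
  rw [e] at h
  rw [← h, qubitMarginal_eq]
  have e2 : E = (prodOp fun _ : {j // j ∈ ({i} : Finset (Fin n))} => E).submatrix
      (siteEquiv (fun _ => Fin 2) i).symm (siteEquiv (fun _ => Fin 2) i).symm := by
    ext a b
    simp only [prodOp, submatrix_apply]
    rw [Fintype.prod_eq_single ⟨i, Finset.mem_singleton_self i⟩]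
    · rfl
    · rintro ⟨j, hj⟩ hne
      exact absurd (Subtype.ext (Finset.mem_singleton.1 hj)) hne
  conv_lhs => rw [e2]
  rw [submatrix_mul_equiv]
  exact (siteEquiv (fun _ => Fin 2) i).symm.sum_comp fun a =>
    (marginal {i} ρ * prodOp fun _ : {j // j ∈ ({i} : Finset (Fin n))} => E) a a

theorem isState_qubitMarginal {ρ : QubitOp n} (hρ : IsState ρ) (i : Fin n) :
    IsState (qubitMarginal ρ i) := by
  constructor
  · have : qubitMarginal ρ i = ∑ z, ρ.submatrix (fun a => glue {i} (fun _ => a) z)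
        (fun a => glue {i} (fun _ => a) z) := by
      ext a b
      simp [qubitMarginal, marginal, Matrix.sum_apply]
    rw [this]
    exact posSemidef_sum _ fun z _ => hρ.1.submatrix _
  · have := trace_qubitMarginal_mul ρ i 1
    rw [Matrix.mul_one, Function.update_eq_self (f := fun _ => 1), prodOp_one, Matrix.mul_one] at this
    rw [this, hρ.2]

/-- A party in a pure state is uncorrelated with the rest. -/
theorem trace_mul_prodOp_of_isPure {ρ : QubitOp n} (hρ : IsState ρ) {i : Fin n}
    (hp : IsPure (qubitMarginal ρ i)) (M : Fin n → Matrix (Fin 2) (Fin 2) ℂ) :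
    (ρ * prodOp M).trace =
      (qubitMarginal ρ i * M i).trace * (ρ * prodOp (Function.update M i 1)).trace := by
  set P := qubitMarginal ρ i with hP
  have hPs := hp.isState
  have hPP : P * P = P := by
    have := hp.mul_mul 1
    rwa [Matrix.mul_one, hPs.2, one_smul] at this
  have h0 : ρ * prodOp (Function.update (fun _ => 1) i (1 - P)) = 0 := by
    refine mul_eq_zero_of_trace_mul_eq_zero hρ.1 ?_
    rw [prodOp_update_one_conjTranspose, prodOp_update_one_mul, ← trace_qubitMarginal_mul, ← hP,
      ← Matrix.mul_assoc, Matrix.mul_sub, Matrix.mul_one, hPP, sub_self, Matrix.zero_mul,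
      trace_zero]
  have h0' : prodOp (Function.update (fun _ => 1) i (1 - P)) * ρ = 0 := by
    have := congrArg Matrix.conjTranspose h0
    rwa [conjTranspose_mul, prodOp_update_one_conjTranspose, hρ.1.1.eq, conjTranspose_zero,
      conjTranspose_sub, conjTranspose_one, hPs.1.1.eq] at this
  have split : ∀ (N : Fin n → Matrix (Fin 2) (Fin 2) ℂ) (A B : Matrix (Fin 2) (Fin 2) ℂ),
      prodOp (Function.update N i (A + B)) =
        prodOp (Function.update N i A) + prodOp (Function.update N i B) := by
    intro N A B
    ext x y
    simp only [prodOp, Matrix.add_apply]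
    rw [← Finset.mul_prod_erase _ _ (Finset.mem_univ i),
      ← Finset.mul_prod_erase _ _ (Finset.mem_univ i),
      ← Finset.mul_prod_erase _ _ (Finset.mem_univ i)]
    have : ∀ C : Matrix (Fin 2) (Fin 2) ℂ, ∏ j ∈ Finset.univ.erase i,
        (Function.update N i C) j (x j) (y j) = ∏ j ∈ Finset.univ.erase i, N j (x j) (y j) :=
      fun C => Finset.prod_congr rfl fun j hj => by
        rw [Function.update_of_ne (Finset.ne_of_mem_erase hj)]
    rw [this, this, this]
    simp only [Function.update_self, Matrix.add_apply, add_mul]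
  have hsite : ∀ (N : Fin n → Matrix (Fin 2) (Fin 2) ℂ) (A : Matrix (Fin 2) (Fin 2) ℂ),
      prodOp (Function.update (fun _ => 1) i A) * prodOp N = prodOp (Function.update N i (A * N i)) := by
    intro N A
    rw [prodOp_mul]
    congr 1
    funext j
    by_cases h : j = i
    · subst h; simp
    · simp [h]
  have hsite' : ∀ (N : Fin n → Matrix (Fin 2) (Fin 2) ℂ) (A : Matrix (Fin 2) (Fin 2) ℂ),
      prodOp N * prodOp (Function.update (fun _ => 1) i A) = prodOp (Function.update N i (N i * A)) := by
    intro N A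
    rw [prodOp_mul]
    congr 1
    funext j
    by_cases h : j = i
    · subst h; simp
    · simp [h]
  have hl : ∀ (N : Fin n → Matrix (Fin 2) (Fin 2) ℂ),
      (ρ * prodOp (Function.update N i (P * N i))).trace = (ρ * prodOp N).trace := by
    intro N
    have h1 : prodOp N = prodOp (Function.update N i (P * N i)) +
        prodOp (Function.update (fun _ => 1) i (1 - P)) * prodOp N := by
      rw [hsite, ← split, ← Matrix.add_mul, add_sub_cancel, Matrix.one_mul,
        Function.update_eq_self]
    conv_rhs => rw [h1, Matrix.mul_add, ← Matrix.mul_assoc, h0, Matrix.zero_mul, add_zero]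
  have hr : ∀ (N : Fin n → Matrix (Fin 2) (Fin 2) ℂ),
      (ρ * prodOp (Function.update N i (N i * P))).trace = (ρ * prodOp N).trace := by
    intro N
    have h1 : prodOp N = prodOp (Function.update N i (N i * P)) +
        prodOp N * prodOp (Function.update (fun _ => 1) i (1 - P)) := by
      rw [hsite', ← split, ← Matrix.mul_add, add_sub_cancel, Matrix.mul_one,
        Function.update_eq_self]
    conv_rhs => rw [h1, Matrix.mul_add, trace_add, ← Matrix.mul_assoc,
      trace_mul_comm (ρ * prodOp N), ← Matrix.mul_assoc, h0', Matrix.zero_mul, trace_zero, add_zero]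
  have hsm : ∀ (c : ℂ) (A : Matrix (Fin 2) (Fin 2) ℂ), prodOp (Function.update M i (c • A)) =
      c • prodOp (Function.update M i A) := by
    intro c A
    have : Function.update M i (c • A) = fun j => (if j = i then c else 1) • (Function.update M i A) j := by
      funext j
      by_cases h : j = i
      · subst h; simp
      · simp [h]
    rw [this, prodOp_smul]
    simp
  -- The observable at `i` may be compressed to `P * M i * P`, a scalar times `P`, and `P` may then
  -- be exchanged for 1.
  have e1 := hr (Function.update M i (P * M i))
  have e2 := hl (Function.update M i 1)
  simp only [Function.update_self, Function.update_idem, Matrix.mul_one] at e1 e2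
  rw [hl, hp.mul_mul, hsm, Matrix.mul_smul, trace_smul, smul_eq_mul] at e1
  rw [← e1, e2]

theorem eq_prodOp_qubitMarginal {τ : QubitOp 2} (hτ : IsState τ)
    (hp : IsPure (qubitMarginal τ 0) ∨ IsPure (qubitMarginal τ 1)) :
    τ = prodOp (qubitMarginal τ) := by
  refine ext_trace_mul_prodOp fun M => ?_
  rw [prodOp_mul, trace_prodOp, Fin.prod_univ_two]
  obtain hp | hp := hp
  · rw [trace_mul_prodOp_of_isPure hτ hp, trace_qubitMarginal_mul τ 1]
    congr 4
    funext j
    fin_cases j <;> simp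
  · rw [trace_mul_prodOp_of_isPure hτ hp, mul_comm, trace_qubitMarginal_mul τ 0]
    congr 4
    funext j
    fin_cases j <;> simp

end Qubits

theorem IsPure.conj {X : Type*} [Fintype X] [DecidableEq X] {A V : Matrix X X ℂ} (hA : IsPure A)
    (hV : Vᴴ * V = 1) : IsPure (V * A * Vᴴ) := by
  obtain ⟨ψ, h1, rfl⟩ := hA
  refine ⟨V *ᵥ ψ, ?_, ?_⟩
  · rw [star_mulVec, ← dotProduct_mulVec, mulVec_mulVec, hV, one_mulVec, h1]
  · rw [mul_vecMulVec, vecMulVec_mul, star_mulVec]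

theorem IsState.conj {X : Type*} [Fintype X] [DecidableEq X] {A V : Matrix X X ℂ} (hA : IsState A)
    (hV : Vᴴ * V = 1) : IsState (V * A * Vᴴ) := by
  refine ⟨hA.1.mul_mul_conjTranspose_same V, ?_⟩
  rw [trace_mul_comm, ← Matrix.mul_assoc, hV, Matrix.one_mul, hA.2]

theorem rank_conj {X : Type*} [Fintype X] [DecidableEq X] (A : Matrix X X ℂ) {V : Matrix X X ℂ}
    (hV : Vᴴ * V = 1) : (V * A * Vᴴ).rank = A.rank := by
  have h : IsUnit V.det := isUnit_det_of_left_inverse hV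
  have h' : IsUnit Vᴴ.det := isUnit_det_of_right_inverse hV
  rw [rank_mul_eq_left_of_isUnit_det _ _ h', rank_mul_eq_right_of_isUnit_det _ _ h]

theorem PosSemidef.col_eq_zero {X : Type*} [Fintype X] [DecidableEq X] {A : Matrix X X ℂ}
    (hA : A.PosSemidef) {i : X} (h : A i i = 0) (j : X) : A j i = 0 := by
  have := (hA.dotProduct_mulVec_zero_iff (Pi.single i 1)).1 (by simp [h])
  simpa using congrFun this j

/-! ### Invariance under local unitaries -/

section LocalUnitary

variable {ι : Type*} [Fintype ι] [DecidableEq ι] {κ : ι → Type*}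
  [∀ i, Fintype (κ i)] [∀ i, DecidableEq (κ i)]

theorem conjTranspose_prodOp_mul_self {U : ∀ i, Matrix (κ i) (κ i) ℂ}
    (hU : ∀ i, U i ∈ unitaryGroup (κ i) ℂ) : (prodOp U)ᴴ * prodOp U = 1 := by
  rw [prodOp_conjTranspose, prodOp_mul, ← prodOp_one]
  exact congrArg prodOp (funext fun i => mem_unitaryGroup_iff'.1 (hU i))

theorem LUEquiv.symm {ρ η : Matrix (∀ i, κ i) (∀ i, κ i) ℂ} (h : LUEquiv ρ η) : LUEquiv η ρ := by
  obtain ⟨U, hU, rfl⟩ := h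
  refine ⟨fun i => (U i)ᴴ, fun i => Unitary.star_mem (hU i), ?_⟩
  rw [← prodOp_conjTranspose, conjTranspose_conjTranspose]
  have h := conjTranspose_prodOp_mul_self hU
  calc ρ = ((prodOp U)ᴴ * prodOp U) * ρ * ((prodOp U)ᴴ * prodOp U) := by
        rw [h, Matrix.one_mul, Matrix.mul_one]
    _ = _ := by simp only [Matrix.mul_assoc]

/-- Conjugation by local unitaries does not enlarge the set of parties on which a product operator
acts. -/
theorem LUEquiv.rigid {ρ η : Matrix (∀ i, κ i) (∀ i, κ i) ℂ} (h : LUEquiv ρ η) {k : ℕ}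
    (hρ : Rigid ρ k) : Rigid η k := by
  obtain ⟨U, hU, rfl⟩ := h
  have h := conjTranspose_prodOp_mul_self hU
  have h' : prodOp U * (prodOp U)ᴴ = 1 := mul_eq_one_comm.1 h
  rintro A ⟨Z, hZ⟩ hv
  have hA : (prodOp U)ᴴ * A * prodOp U = 0 := by
    refine hρ _ ⟨(prodOp U)ᴴ * Z * prodOp U, ?_⟩ fun T M hT hM => ?_
    · rw [hZ]
      calc _ = ((prodOp U)ᴴ * prodOp U) * ρ * ((prodOp U)ᴴ * Z * prodOp U) * ρ *
            ((prodOp U)ᴴ * prodOp U) := by simp only [Matrix.mul_assoc]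
        _ = _ := by rw [h, Matrix.one_mul, Matrix.mul_one]
    · have := hv T (fun i => U i * M i * (U i)ᴴ) hT fun i hi => by
        rw [hM i hi, Matrix.mul_one]
        exact mem_unitaryGroup_iff.1 (hU i)
      rw [← this, ← prodOp_mul, ← prodOp_mul, ← prodOp_conjTranspose, Matrix.mul_assoc,
        Matrix.mul_assoc, trace_mul_comm]
      simp only [Matrix.mul_assoc]
  calc A = (prodOp U * (prodOp U)ᴴ) * A * (prodOp U * (prodOp U)ᴴ) := by
        rw [h', Matrix.one_mul, Matrix.mul_one]
    _ = prodOp U * ((prodOp U)ᴴ * A * prodOp U) * (prodOp U)ᴴ := by simp only [Matrix.mul_assoc]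
    _ = 0 := by rw [hA, Matrix.mul_zero, Matrix.zero_mul]

theorem LUEquiv.isState {ρ η : Matrix (∀ i, κ i) (∀ i, κ i) ℂ} (h : LUEquiv ρ η)
    (hρ : IsState ρ) : IsState η := by
  obtain ⟨U, hU, rfl⟩ := h
  exact hρ.conj (conjTranspose_prodOp_mul_self hU)

theorem LUEquiv.rank_eq {ρ η : Matrix (∀ i, κ i) (∀ i, κ i) ℂ} (h : LUEquiv ρ η) :
    η.rank = ρ.rank := by
  obtain ⟨U, hU, rfl⟩ := h
  exact rank_conj ρ (conjTranspose_prodOp_mul_self hU)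

end LocalUnitary

theorem LUEquiv.isPure_qubitMarginal {n : ℕ} {ρ η : QubitOp n} (h : LUEquiv ρ η) {i : Fin n}
    (hp : IsPure (qubitMarginal ρ i)) : IsPure (qubitMarginal η i) := by
  obtain ⟨U, hU, rfl⟩ := h
  have hU' : ∀ i, (U i)ᴴ * U i = 1 := fun i => mem_unitaryGroup_iff'.1 (hU i)
  have : qubitMarginal (prodOp U * ρ * (prodOp U)ᴴ) i = U i * qubitMarginal ρ i * (U i)ᴴ := by
    rw [ext_iff_trace_mul_right]
    intro E
    rw [trace_qubitMarginal_mul, Matrix.mul_assoc, Matrix.mul_assoc, trace_mul_comm,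
      prodOp_conjTranspose, prodOp_mul, Matrix.mul_assoc, prodOp_mul]
    have e : (fun j => (U j)ᴴ * Function.update (fun _ => (1 : Matrix (Fin 2) (Fin 2) ℂ)) i E j * U j) =
        Function.update (fun _ => 1) i ((U i)ᴴ * E * U i) := by
      funext j
      by_cases hj : j = i
      · subst hj; simp
      · simp [hj, hU']
    rw [e, ← trace_qubitMarginal_mul, Matrix.mul_assoc (U i), Matrix.mul_assoc (U i),
      trace_mul_comm (U i)]
    simp only [Matrix.mul_assoc]
  rw [this]
  exact hp.conj (hU' i)

theorem vanish_two_iff {n : ℕ} (hn : 0 < n) (A : QubitOp n) :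
    Vanish 2 A ↔ ∀ i, qubitMarginal A i = 0 := by
  constructor
  · intro h i
    rw [ext_iff_trace_mul_right]
    intro E
    rw [trace_qubitMarginal_mul, Matrix.zero_mul, trace_zero]
    exact h {i} _ (by simp) fun j hj => Function.update_of_ne (by simpa using hj) _ _
  · intro h T M hT hM
    obtain ⟨i, hi⟩ : ∃ i, T ⊆ {i} := by
      obtain hT0 | hT1 : T.card = 0 ∨ T.card = 1 := by omega
      · exact ⟨⟨0, hn⟩, by simp [Finset.card_eq_zero.1 hT0]⟩
      · obtain ⟨i, rfl⟩ := Finset.card_eq_one.1 hT1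
        exact ⟨i, subset_rfl⟩
    have e : M = Function.update (fun _ => 1) i (M i) := by
      funext j
      by_cases hj : j = i
      · subst hj; simp
      · rw [Function.update_of_ne hj, hM j fun h' => hj (by simpa using hi h')]
    rw [e, ← trace_qubitMarginal_mul, h, Matrix.zero_mul, trace_zero]

/-! ### Two-qubit states of weight at most one -/

section TwoQubits

theorem sum_two_qubits (f : (Fin 2 → Fin 2) → ℂ) :
    ∑ x, f x = f ![0, 0] + f ![0, 1] + (f ![1, 0] + f ![1, 1]) := by
  rw [← (finTwoArrowEquiv (Fin 2)).symm.sum_comp f, Fintype.sum_prod_type]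
  simp [Fin.sum_univ_two]

theorem forall_two_qubits {p : (Fin 2 → Fin 2) → Prop} :
    (∀ x, p x) ↔ p ![0, 0] ∧ p ![0, 1] ∧ p ![1, 0] ∧ p ![1, 1] := by
  constructor
  · exact fun h => ⟨h _, h _, h _, h _⟩
  · rintro ⟨h1, h2, h3, h4⟩ x
    have hx : x = ![x 0, x 1] := by
      funext i
      fin_cases i <;> rfl
    rw [hx]
    generalize x 0 = a
    generalize x 1 = b
    fin_cases a <;> fin_cases b <;> assumption

theorem qubitMarginal_zero_apply (A : QubitOp 2) (a b : Fin 2) :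
    qubitMarginal A 0 a b = A ![a, 0] ![b, 0] + A ![a, 1] ![b, 1] := by
  have := trace_qubitMarginal_mul A 0 (single b a 1)
  rw [trace_mul_single] at this
  simp only [MulOpposite.op_one, one_smul] at this
  rw [this]
  simp only [trace, diag_apply, mul_apply, sum_two_qubits, prodOp, Fin.prod_univ_two]
  fin_cases a <;> fin_cases b <;> simp

theorem qubitMarginal_one_apply (A : QubitOp 2) (a b : Fin 2) :
    qubitMarginal A 1 a b = A ![0, a] ![0, b] + A ![1, a] ![1, b] := by
  have := trace_qubitMarginal_mul A 1 (single b a 1)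
  rw [trace_mul_single] at this
  simp only [MulOpposite.op_one, one_smul] at this
  rw [this]
  simp only [trace, diag_apply, mul_apply, sum_two_qubits, prodOp, Fin.prod_univ_two]
  fin_cases a <;> fin_cases b <;> simp

end TwoQubits

theorem isPure_of_rank_le_one {X : Type*} [Fintype X] {ρ : Matrix X X ℂ} (hρ : IsState ρ)
    (h : ρ.rank ≤ 1) : IsPure ρ := by
  classical
  obtain ⟨⟨w, hw⟩, hwc⟩ := finrank_le_one_iff.1 h
  have hc : ∀ v, ∃ c : ℂ, ρ *ᵥ v = c • w := fun v => by
    obtain ⟨c, hc⟩ := hwc ⟨ρ *ᵥ v, ⟨v, rfl⟩⟩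
    exact ⟨c, (congrArg Subtype.val hc).symm⟩
  choose c hc using hc
  obtain ⟨v, rfl⟩ := hw
  rw [mulVecLin_apply] at hc
  have hw0 : ρ *ᵥ v ≠ 0 := by
    intro h0
    refine hρ.ne_zero (Matrix.ext_of_mulVec_single fun j => ?_)
    rw [hc, h0, smul_zero, zero_mulVec]
  have e : ρ = vecMulVec (ρ *ᵥ v) (fun j => c (Pi.single j 1)) := by
    ext i j
    have := congrFun (hc (Pi.single j 1)) i
    simpa [vecMulVec_apply, mul_comm] using this
  refine isPure_of_smul_eq hρ (c := star v ⬝ᵥ (ρ *ᵥ v)) hw0 ?_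
  have e2 : star (ρ *ᵥ v) = (star v ⬝ᵥ (ρ *ᵥ v)) • fun j => c (Pi.single j 1) := by
    rw [star_mulVec, hρ.1.1.eq]
    conv_lhs => rw [e, vecMul_vecMulVec]
  rw [e2, vecMulVec_smul, ← e]

theorem finrank_ker_mulVecLin (τ : QubitOp 2) :
    τ.rank + Module.finrank ℂ τ.mulVecLin.ker = 4 := by
  have := τ.mulVecLin.finrank_range_add_finrank_ker
  simpa [Matrix.rank] using this

/-- A three-dimensional part of the range carries a 9-dimensional space of operators, while the two
1-marginals have only 8 entries in total. -/
theorem rank_le_two_of_rigid {τ : QubitOp 2} (hτ : IsState τ) (h : Rigid τ 1) : τ.rank ≤ 2 := by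
  by_contra! hr
  obtain ⟨V, d, h1, h2, hV⟩ := exists_unitary_diagonalization hτ.1.1
  have hcard : 3 ≤ Fintype.card {i // (d i : ℂ) ≠ 0} := by
    rw [← rank_diagonal, ← rank_conj _ h1, ← hV]
    exact hr
  obtain ⟨j⟩ : Nonempty (Fin 3 ↪ {i // (d i : ℂ) ≠ 0}) :=
    Function.Embedding.nonempty_of_card_le (by simpa using hcard)
  set f : Fin 3 → (Fin 2 → Fin 2) := fun i => (j i).1 with hf
  have hfi : Function.Injective f := fun a b hab => j.injective (Subtype.ext hab)
  have hd : ∀ i, (d (f i) : ℂ) ≠ 0 := fun i => (j i).2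
  set W : Matrix (Fin 2 → Fin 2) (Fin 3) ℂ := V.submatrix id f with hW
  have hWW : Wᴴ * W = 1 := by
    have : Wᴴ * W = (Vᴴ * V).submatrix f f := by
      rw [hW, conjTranspose_submatrix, submatrix_mul _ _ f id f Function.bijective_id]
    rw [this, h1, submatrix_one _ hfi]
  -- The columns of `W` are eigenvectors of nonzero eigenvalue, so every `W * Z * Wᴴ` is supported
  -- on `τ`.
  have hτW : τ * W * diagonal (fun i => (d (f i) : ℂ)⁻¹) = W := by
    have e1 : τ * V = V * diagonal (fun i => (d i : ℂ)) := by
      conv_lhs => rw [hV, Matrix.mul_assoc, h1, Matrix.mul_one]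
    have e2 : τ * W = (τ * V).submatrix id f := by
      rw [hW]
      exact submatrix_mul_equiv τ V id (Equiv.refl _) f
    rw [e2, e1]
    ext x i
    simp [hW, hd i]
  let L : Matrix (Fin 3) (Fin 3) ℂ →ₗ[ℂ] (Fin 2 × Fin 2 × Fin 2 → ℂ) :=
    { toFun := fun Z p => qubitMarginal (W * Z * Wᴴ) p.1 p.2.1 p.2.2
      map_add' := fun Y Z => by
        funext p
        simp [qubitMarginal, marginal, Matrix.mul_add, Matrix.add_mul, Finset.sum_add_distrib]
      map_smul' := fun c Z => by
        funext p
        simp [qubitMarginal, marginal, Finset.mul_sum] }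
  have hlt : Module.finrank ℂ (Fin 2 × Fin 2 × Fin 2 → ℂ) <
      Module.finrank ℂ (Matrix (Fin 3) (Fin 3) ℂ) := by
    rw [Module.finrank_fintype_fun_eq_card, Module.finrank_matrix]
    simp
  obtain ⟨Z, hZ, hZ0⟩ := (Submodule.ne_bot_iff _).1 (LinearMap.ker_ne_bot_of_finrank_lt hlt (f := L))
  refine hZ0 ?_
  have h0 : W * Z * Wᴴ = 0 := by
    refine h _ ?_ ((vanish_two_iff (by norm_num) _).2 fun i => ?_)
    · set D := diagonal (fun i => (d (f i) : ℂ)⁻¹)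
      refine ⟨W * D * Z * (W * D)ᴴ, ?_⟩
      conv_lhs => rw [← hτW]
      simp only [conjTranspose_mul, hτ.1.1.eq, Matrix.mul_assoc]
    · ext a b
      exact congrFun hZ (i, a, b)
  calc Z = (Wᴴ * W) * Z * (Wᴴ * W) := by rw [hWW, Matrix.one_mul, Matrix.mul_one]
    _ = Wᴴ * (W * Z * Wᴴ) * W := by simp only [Matrix.mul_assoc]
    _ = 0 := by rw [h0, Matrix.mul_zero, Matrix.zero_mul]

/-- A singular `2 × 2` array has rank one. -/
theorem exists_product_of_det_eq_zero {u : (Fin 2 → Fin 2) → ℂ} (hu : u ≠ 0)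
    (hdet : u ![0, 0] * u ![1, 1] = u ![0, 1] * u ![1, 0]) :
    ∃ a b : Fin 2 → ℂ, a ≠ 0 ∧ b ≠ 0 ∧ u = fun x => a (x 0) * b (x 1) := by
  obtain ⟨x, hx⟩ := Function.ne_iff.1 hu
  have hx' : x = ![x 0, x 1] := by
    funext i
    fin_cases i <;> rfl
  rw [hx'] at hx
  generalize x 0 = p at hx
  generalize x 1 = q at hx
  simp only [Pi.zero_apply] at hx
  refine ⟨fun i => u ![i, q], fun j => u ![p, j] / u ![p, q], fun h => hx (congrFun h p), fun h =>
    one_ne_zero (α := ℂ) ?_, funext ?_⟩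
  · have := congrFun h q
    rwa [div_self hx] at this
  · rw [forall_two_qubits]
    fin_cases p <;> fin_cases q <;> simp only [Fin.zero_eta, Fin.mk_one, Fin.isValue] at hx ⊢ <;>
      refine ⟨?_, ?_, ?_, ?_⟩ <;> simp only [cons_val_zero, cons_val_one] <;>
      field_simp <;> first | rfl | linear_combination hdet | linear_combination -hdet

/-- The kernel has dimension at least two. Product vectors are the zeros of a determinant, and on
the pencil `t • v + w` this determinant is a polynomial in `t`, with a root in `ℂ` when its
quadratic coefficient is nonzero; otherwise `v` itself is a product. -/
theorem exists_product_ker {τ : QubitOp 2} (h : τ.rank ≤ 2) :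
    ∃ a b : Fin 2 → ℂ, a ≠ 0 ∧ b ≠ 0 ∧ (τ *ᵥ fun x => a (x 0) * b (x 1)) = 0 := by
  have hk := finrank_ker_mulVecLin τ
  obtain ⟨v, hv⟩ : ∃ v : τ.mulVecLin.ker, v ≠ 0 := by
    have : Nontrivial τ.mulVecLin.ker := Module.nontrivial_of_finrank_pos (R := ℂ) (by omega)
    exact exists_ne 0
  obtain ⟨w, hw⟩ := exists_linearIndependent_pair_of_one_lt_finrank (R := ℂ) (by omega) hv
  rw [LinearIndependent.pair_iff] at hw
  suffices h' : ∃ u : τ.mulVecLin.ker, u ≠ 0 ∧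
      u.1 ![0, 0] * u.1 ![1, 1] = u.1 ![0, 1] * u.1 ![1, 0] by
    obtain ⟨u, hu, hdet⟩ := h'
    obtain ⟨a, b, ha, hb, hab⟩ := exists_product_of_det_eq_zero
      (u := u.1) (fun h => hu (Subtype.ext h)) hdet
    exact ⟨a, b, ha, hb, by rw [← hab]; exact u.2⟩
  by_cases hA : v.1 ![0, 0] * v.1 ![1, 1] - v.1 ![0, 1] * v.1 ![1, 0] = 0
  · exact ⟨v, hv, sub_eq_zero.1 hA⟩
  · obtain ⟨t, ht⟩ := exists_quadratic_eq_zero (b := v.1 ![0, 0] * w.1 ![1, 1] +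
      w.1 ![0, 0] * v.1 ![1, 1] - v.1 ![0, 1] * w.1 ![1, 0] - w.1 ![0, 1] * v.1 ![1, 0])
      (c := w.1 ![0, 0] * w.1 ![1, 1] - w.1 ![0, 1] * w.1 ![1, 0]) hA
      (IsAlgClosed.exists_eq_mul_self _)
    refine ⟨t • v + w, fun h0 => ?_, ?_⟩
    · have := (hw t 1 (by rwa [one_smul])).2
      exact one_ne_zero this
    · simp only [Submodule.coe_add, Submodule.coe_smul, Pi.add_apply, Pi.smul_apply, smul_eq_mul]
      linear_combination ht

theorem exists_unitary_col {a : Fin 2 → ℂ} (ha : a ≠ 0) :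
    ∃ G ∈ unitaryGroup (Fin 2) ℂ, ∃ c : ℂ, ∀ i, G i 1 = c * a i := by
  set N : ℝ := Complex.normSq (a 0) + Complex.normSq (a 1) with hN
  have hNpos : 0 < N := by
    obtain ⟨i, hi⟩ := Function.ne_iff.1 ha
    rw [hN, ← Fin.sum_univ_two fun i => Complex.normSq (a i)]
    exact Finset.sum_pos' (fun _ _ => Complex.normSq_nonneg _)
      ⟨i, Finset.mem_univ i, Complex.normSq_pos.2 hi⟩
  set s : ℂ := ((Real.sqrt N : ℝ) : ℂ)⁻¹ with hs
  have hss : star s = s := by rw [hs, star_inv₀]; congr 1; exact Complex.conj_ofReal _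
  have hsN : s * s * (star (a 0) * a 0 + star (a 1) * a 1) = 1 := by
    have : star (a 0) * a 0 + star (a 1) * a 1 = (N : ℂ) := by
      rw [hN, Complex.ofReal_add, Complex.normSq_eq_conj_mul_self, Complex.normSq_eq_conj_mul_self]
      rfl
    rw [this, hs, ← mul_inv, ← Complex.ofReal_mul, Real.mul_self_sqrt hNpos.le]
    exact inv_mul_cancel₀ (by exact_mod_cast hNpos.ne')
  -- The second column is `a` normalized, the first its orthogonal complement.
  refine ⟨!![-(s * star (a 1)), s * a 0; s * star (a 0), s * a 1], ?_, s, ?_⟩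
  · rw [mem_unitaryGroup_iff']
    ext i j
    fin_cases i <;> fin_cases j <;>
      simp [Matrix.star_eq_conjTranspose, mul_apply, Fin.sum_univ_two, conjTranspose_apply] <;>
      simp only [← Complex.star_def, hss] <;> first | linear_combination hsN | ring
  · intro i
    fin_cases i <;> rfl

/-- The operator `|01⟩⟨10| + |10⟩⟨01|`. -/
def flip : QubitOp 2 := single ![0, 1] ![1, 0] 1 + single ![1, 0] ![0, 1] 1

theorem flip_isHermitian : flip.IsHermitian := by
  rw [IsHermitian, flip, conjTranspose_add, conjTranspose_single, conjTranspose_single, star_one,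
    add_comm]

theorem flip_mulVec (v : (Fin 2 → Fin 2) → ℂ) (h1 : v ![0, 1] = 0) (h2 : v ![1, 0] = 0) :
    flip *ᵥ v = 0 := by
  rw [flip, add_mulVec, single_mulVec, single_mulVec, h1, h2]
  simp

theorem flip_ne_zero : flip ≠ 0 := by
  intro h
  have := congrFun (congrFun h ![0, 1]) ![1, 0]
  simp [flip] at this

/-- Both qubits change between `|01⟩` and `|10⟩`, so tracing out either one gives zero. -/
theorem flip_vanish : Vanish 2 flip := by
  rw [vanish_two_iff (by norm_num)]
  intro i
  ext a b
  fin_cases i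
  · simp only [Fin.zero_eta, qubitMarginal_zero_apply]
    fin_cases a <;> fin_cases b <;> simp [flip]
  · simp only [Fin.mk_one, qubitMarginal_one_apply]
    fin_cases a <;> fin_cases b <;> simp [flip]

/-- If a rank-two matrix has only `|00⟩` and `|11⟩` in its kernel, it is not rigid. -/
theorem not_rigid_of_ker {η : QubitOp 2} (hη : η.IsHermitian) (hr : η.rank = 2)
    (h0 : ∀ x, η x ![0, 0] = 0) (h1 : ∀ x, η x ![1, 1] = 0) : ¬ Rigid η 1 := by
  intro h
  -- By rank two the kernel is exactly the span of `|00⟩` and `|11⟩`, which `flip` annihilates.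
  refine flip_ne_zero (h _ (supp_of_ker hη flip_isHermitian fun v hv => ?_) flip_vanish)
  have hk := finrank_ker_mulVecLin η
  set e : Fin 2 → ((Fin 2 → Fin 2) → ℂ) := ![Pi.single ![0, 0] 1, Pi.single ![1, 1] 1] with he
  have hli : LinearIndependent ℂ e := by
    rw [he, LinearIndependent.pair_iff]
    intro s t hst
    have e0 := congrFun hst ![0, 0]
    have e1 := congrFun hst ![1, 1]
    constructor
    · simpa using e0
    · simpa using e1
  have hle : Submodule.span ℂ (Set.range e) ≤ η.mulVecLin.ker := by
    rw [Submodule.span_le]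
    rintro _ ⟨i, rfl⟩
    rw [SetLike.mem_coe, LinearMap.mem_ker, mulVecLin_apply]
    funext x
    fin_cases i
    · simpa [he] using h0 x
    · simpa [he] using h1 x
  have heq := Submodule.eq_of_le_of_finrank_eq hle (by
    rw [finrank_span_eq_card hli, Fintype.card_fin]
    omega)
  have hmem : v ∈ Submodule.span ℂ (Set.range e) := by
    rw [heq, LinearMap.mem_ker, mulVecLin_apply, hv]
  rw [he, Matrix.range_cons_cons_empty, Submodule.mem_span_pair] at hmem
  obtain ⟨a, b, rfl⟩ := hmem
  refine flip_mulVec _ ?_ ?_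
  · simp
  · simp

/-- Vanishing marginals, and a zero row and column at `|11⟩`, leave only the two entries between
`|01⟩` and `|10⟩`. A second kernel vector of `η`, acting from both sides, removes these. -/
theorem rigid_one_of_isCornerForm {η : QubitOp 2} (hη : IsCornerForm η) (hr : η.rank = 2) :
    Rigid η 1 := by
  obtain ⟨hs, q₁, q₂, q₃, x, y, z, hq, he⟩ := hη
  have hcol : ∀ p, η p ![1, 1] = 0 := by
    rw [forall_two_qubits, he]
    refine ⟨rfl, rfl, rfl, rfl⟩
  have h00 : η ![0, 0] ![0, 0] ≠ 0 := by
    have : η ![0, 0] ![0, 0] = (q₁ : ℂ) := by rw [he]; rfl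
    rw [this]
    intro h
    rw [Complex.ofReal_eq_zero.1 h] at hq
    simp at hq
  have hrow : ∀ p, η ![1, 1] p = 0 := fun p => by
    rw [← hs.1.1.apply, hcol, star_zero]
  rintro A ⟨Z, hA⟩ hv
  have hk := finrank_ker_mulVecLin η
  let φ : η.mulVecLin.ker →ₗ[ℂ] ℂ := (LinearMap.proj ![1, 1]).comp η.mulVecLin.ker.subtype
  -- A linear functional on the two-dimensional kernel has a nonzero zero; this gives a kernel
  -- vector without `|11⟩` component.
  obtain ⟨⟨v, hvk⟩, hv1, hv0⟩ := (Submodule.ne_bot_iff _).1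
    (LinearMap.ker_ne_bot_of_finrank_lt (f := φ) (by rw [Module.finrank_self]; omega))
  replace hv1 : v ![1, 1] = 0 := hv1
  replace hv0 : v ≠ 0 := fun h => hv0 (Subtype.ext h)
  replace hvk : η *ᵥ v = 0 := hvk
  have hAv : A *ᵥ v = 0 := by rw [hA, ← mulVec_mulVec, hvk, mulVec_zero]
  have hvA : star v ᵥ* A = 0 := by
    have : star v ᵥ* η = 0 := by
      rw [← hs.1.1.eq, ← star_mulVec, hvk, star_zero]
    rw [hA, ← vecMul_vecMul, ← vecMul_vecMul, this, zero_vecMul, zero_vecMul]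
  have hAcol : ∀ p, A p ![1, 1] = 0 := fun p => by
    rw [hA, mul_apply]
    exact Finset.sum_eq_zero fun t _ => by rw [hcol, mul_zero]
  have hArow : ∀ p, A ![1, 1] p = 0 := fun p => by
    rw [hA, Matrix.mul_assoc, mul_apply]
    exact Finset.sum_eq_zero fun t _ => by rw [hrow, zero_mul]
  rw [vanish_two_iff (by norm_num)] at hv
  have hm0 : ∀ a b, A ![a, 0] ![b, 0] + A ![a, 1] ![b, 1] = 0 := fun a b => by
    rw [← qubitMarginal_zero_apply, hv, Matrix.zero_apply]
  have hm1 : ∀ a b, A ![0, a] ![0, b] + A ![1, a] ![1, b] = 0 := fun a b => by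
    rw [← qubitMarginal_one_apply, hv, Matrix.zero_apply]
  have a1 := hm0 0 0
  have a2 := hm0 0 1
  have a3 := hm0 1 0
  have a4 := hm0 1 1
  have b1 := hm1 0 0
  have b2 := hm1 0 1
  have b3 := hm1 1 0
  simp only [hAcol, hArow, add_zero] at a2 a3 a4 b2 b3
  rw [a4, add_zero] at b1
  rw [b1, zero_add] at a1
  have r1 := congrFun hAv ![0, 1]
  have r2 := congrFun hAv ![1, 0]
  have c1 := congrFun hvA ![0, 1]
  have c2 := congrFun hvA ![1, 0]
  simp only [mulVec, vecMul, dotProduct, sum_two_qubits, hAcol, hArow, a1, a2, a3, a4, b2, b3,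
    Pi.zero_apply, Pi.star_apply, zero_mul, mul_zero, zero_add, add_zero, mul_eq_zero,
    star_eq_zero] at r1 r2 c1 c2
  -- Otherwise `|00⟩` would be in the kernel, against `q₁ ≠ 0`.
  have hv' : ¬ (v ![0, 1] = 0 ∧ v ![1, 0] = 0) := by
    rintro ⟨h1, h2⟩
    apply hv0
    have := congrFun hvk ![0, 0]
    simp only [mulVec, dotProduct, sum_two_qubits, h1, h2, hv1, mul_zero, add_zero,
      Pi.zero_apply, mul_eq_zero, h00, false_or] at this
    exact funext (forall_two_qubits.2 ⟨this, h1, h2, hv1⟩)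
  have z1 : A ![0, 1] ![1, 0] = 0 := by tauto
  have z2 : A ![1, 0] ![0, 1] = 0 := by tauto
  have key : ∀ p q, A p q = 0 := by
    rw [forall_two_qubits]
    simp only [forall_two_qubits]
    exact ⟨⟨b1, b2, a2, hAcol _⟩, ⟨b3, a1, z1, hAcol _⟩, ⟨a3, z2, a4, hAcol _⟩,
      ⟨hArow _, hArow _, hArow _, hArow _⟩⟩
  exact Matrix.ext key

theorem isCornerForm_of_col {η : QubitOp 2} (hη : IsState η) (h : ∀ x, η x ![1, 1] = 0)
    (h1 : η ![0, 0] ![0, 0] ≠ 0) (h2 : η ![0, 1] ![0, 1] ≠ 0) (h3 : η ![1, 0] ![1, 0] ≠ 0) :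
    IsCornerForm η := by
  have hrow : ∀ p, η ![1, 1] p = 0 := fun p => by
    rw [← hη.1.1.apply, h, star_zero]
  have hre : ∀ p, ((η p p).re : ℂ) = η p p := fun p => hη.1.1.coe_re_apply_self p
  have hpos : ∀ p, η p p ≠ 0 → 0 < (η p p).re := fun p hp => by
    have h0 : 0 ≤ η p p := hη.1.diag_nonneg
    rw [← hre, Complex.zero_le_real] at h0
    refine lt_of_le_of_ne h0 fun h' => hp ?_
    rw [← hre, ← h', Complex.ofReal_zero]
  refine ⟨hη, (η ![0, 0] ![0, 0]).re, (η ![0, 1] ![0, 1]).re, (η ![1, 0] ![1, 0]).re,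
    η ![0, 1] ![1, 0], η ![0, 0] ![0, 1], η ![0, 0] ![1, 0],
    mul_pos (mul_pos (hpos _ h1) (hpos _ h2)) (hpos _ h3), ?_⟩
  simp only [hre, hη.1.1.apply]
  refine Matrix.ext ?_
  rw [forall_two_qubits]
  simp only [forall_two_qubits]
  exact ⟨⟨rfl, rfl, rfl, h _⟩, ⟨rfl, rfl, rfl, h _⟩, ⟨rfl, rfl, rfl, h _⟩,
    ⟨hrow _, hrow _, hrow _, hrow _⟩⟩

/-- A qubit state with a vanishing diagonal entry is pure. -/
theorem isPure_of_apply_one_one_eq_zero {A : Matrix (Fin 2) (Fin 2) ℂ} (hA : IsState A)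
    (h : A 1 1 = 0) : IsPure A := by
  refine ⟨Pi.single 0 1, by simp, ?_⟩
  have hc := PosSemidef.col_eq_zero hA.1 h
  have hr : A 1 0 = 0 := by rw [← hA.1.1.apply, hc, star_zero]
  have ht := hA.2
  rw [trace_fin_two, h, add_zero] at ht
  ext i j
  fin_cases i <;> fin_cases j <;> simp [vecMulVec_apply, ht, hc, hr]

theorem exists_luEquiv_col_eq_zero {τ : QubitOp 2} (hr : τ.rank ≤ 2) :
    ∃ η, LUEquiv τ η ∧ ∀ x, η x ![1, 1] = 0 := by
  obtain ⟨a, b, ha, hb, hab⟩ := exists_product_ker hr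
  obtain ⟨G, hG, c, hGc⟩ := exists_unitary_col ha
  obtain ⟨H, hH, d, hHd⟩ := exists_unitary_col hb
  set W : Fin 2 → Matrix (Fin 2) (Fin 2) ℂ := ![G, H] with hW
  refine ⟨(prodOp W)ᴴ * τ * prodOp W, ⟨fun i => (W i)ᴴ, fun i => ?_, ?_⟩, fun x => ?_⟩
  · refine Unitary.star_mem ?_
    fin_cases i
    · exact hG
    · exact hH
  · rw [← prodOp_conjTranspose, conjTranspose_conjTranspose]
  · have e : prodOp W *ᵥ Pi.single ![1, 1] 1 = (c * d) • fun x => a (x 0) * b (x 1) := by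
      funext p
      rw [mulVec_single_one]
      simp [prodOp, hW, hGc, hHd]
      ring
    have : ((prodOp W)ᴴ * τ * prodOp W) *ᵥ Pi.single ![1, 1] 1 = 0 := by
      rw [← mulVec_mulVec, ← mulVec_mulVec, e, mulVec_smul, hab, smul_zero, mulVec_zero]
    simpa using congrFun this x

/-- Characterization of the two-qubit states that no other state on the same range shares both
1-marginals with. -/
theorem rigid_one_iff {τ : QubitOp 2} (hτ : IsState τ) : Rigid τ 1 ↔
    IsPure τ ∨ (IsPure (qubitMarginal τ 0) ∨ IsPure (qubitMarginal τ 1)) ∨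
      (τ.rank = 2 ∧ ∃ η, IsCornerForm η ∧ LUEquiv τ η) := by
  constructor
  · intro h
    by_contra! hcon
    obtain ⟨hp, ⟨hp0, hp1⟩, hcor⟩ := hcon
    have hr := rank_le_two_of_rigid hτ h
    have hr2 : τ.rank = 2 := by
      by_contra hne
      exact hp (isPure_of_rank_le_one hτ (by omega))
    obtain ⟨η, hη, hcol⟩ := exists_luEquiv_col_eq_zero hr
    have hηs := hη.isState hτ
    -- With `|11⟩` in the kernel, a zero diagonal entry at `|00⟩` makes `flip` a witness, one at
    -- `|01⟩` makes the second marginal pure, and one at `|10⟩` the first.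
    refine hcor hr2 η (isCornerForm_of_col hηs hcol ?_ ?_ ?_) hη
    · intro h0
      exact not_rigid_of_ker hηs.1.1 (hη.rank_eq.trans hr2)
        (PosSemidef.col_eq_zero hηs.1 h0) hcol (hη.rigid h)
    · intro h0
      refine hp1 (hη.symm.isPure_qubitMarginal
        (isPure_of_apply_one_one_eq_zero (isState_qubitMarginal hηs 1) ?_))
      rw [qubitMarginal_one_apply, h0, hcol, add_zero]
    · intro h0
      refine hp0 (hη.symm.isPure_qubitMarginal
        (isPure_of_apply_one_one_eq_zero (isState_qubitMarginal hηs 0) ?_))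
      rw [qubitMarginal_zero_apply, h0, hcol, add_zero]
  · rintro (hp | hp | ⟨hr, η, hη, hl⟩)
    · exact ((rigid_zero_iff hτ).2 hp).mono zero_le_one
    · rw [eq_prodOp_qubitMarginal hτ hp]
      refine (hasWeight_prodOp (isState_qubitMarginal hτ) 1).2 ?_
      obtain ⟨i, hi⟩ : ∃ i, IsPure (qubitMarginal τ i) := by
        obtain hp | hp := hp
        exacts [⟨0, hp⟩, ⟨1, hp⟩]
      classical
      have hlt : (Finset.univ.filter fun i => ¬ IsPure (qubitMarginal τ i)).card < 2 := by
        refine (Finset.card_lt_card ((Finset.filter_ssubset).2 ⟨i, Finset.mem_univ i, ?_⟩)).trans_eq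
          (Finset.card_fin 2)
        exact not_not.2 hi
      have := Nat.le_of_lt_succ hlt
      convert! this
    · exact hl.symm.rigid (rigid_one_of_isCornerForm hη (hl.rank_eq.trans hr))

/-! ### The listed conditions as inequalities between weights -/

theorem HasWeight.unique {ι : Type*} [Fintype ι] [DecidableEq ι] {κ : ι → Type*}
    [∀ i, Fintype (κ i)] [∀ i, DecidableEq (κ i)] {ρ : Matrix (∀ i, κ i) (∀ i, κ i) ℂ} {v w : ℕ}
    (hv : HasWeight ρ v) (hw : HasWeight ρ w) : v = w :=
  le_antisymm ((hv w).1 ((hw w).2 le_rfl)) ((hw v).1 ((hv v).2 le_rfl))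

theorem isPure_iff_weight {n : ℕ} {ρ : QubitOp n} (hρ : IsState ρ) {w : ℕ} (hw : HasWeight ρ w) :
    IsPure ρ ↔ w = 0 := by
  rw [← rigid_zero_iff hρ, hw, Nat.le_zero]

theorem isPure_prodOp_iff {n : ℕ} {σ : Fin n → Matrix (Fin 2) (Fin 2) ℂ}
    (hσ : ∀ i, IsState (σ i)) : IsPure (prodOp σ) ↔ mixedCount σ = 0 :=
  isPure_iff_weight (isState_prodOp hσ) (hasWeight_prodOp hσ)

theorem isState_append {m l : ℕ} {σ : Fin m → Matrix (Fin 2) (Fin 2) ℂ}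
    {σ' : Fin l → Matrix (Fin 2) (Fin 2) ℂ} (hσ : ∀ i, IsState (σ i)) (hσ' : ∀ i, IsState (σ' i))
    (i : Fin (m + l)) : IsState (Fin.append σ σ' i) := by
  induction i using Fin.addCases with
  | left i => rw [Fin.append_left]; exact hσ i
  | right i => rw [Fin.append_right]; exact hσ' i

theorem tensor_prodOp_eq {m : ℕ} (σ : Fin m → Matrix (Fin 2) (Fin 2) ℂ) {τ : QubitOp 2}
    (hτ : IsState τ) (hp : IsPure (qubitMarginal τ 0) ∨ IsPure (qubitMarginal τ 1)) :
    tensor (prodOp σ) τ = prodOp (Fin.append σ (qubitMarginal τ)) := by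
  rw [prodOp_append, ← eq_prodOp_qubitMarginal hτ hp]

theorem mixedCount_append_qubitMarginal {m : ℕ} {σ : Fin m → Matrix (Fin 2) (Fin 2) ℂ}
    {τ : QubitOp 2} (hσ : ∀ i, IsState (σ i)) (hτ : IsState τ)
    (hp : IsPure (qubitMarginal τ 0) ∨ IsPure (qubitMarginal τ 1)) {w : ℕ} (hw : HasWeight τ w) :
    mixedCount (Fin.append σ (qubitMarginal τ)) = mixedCount σ + w := by
  have h1 : HasWeight (prodOp (Fin.append σ (qubitMarginal τ))) _ :=
    hasWeight_prodOp (isState_append hσ (isState_qubitMarginal hτ))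
  have h2 := (hasWeight_prodOp hσ).tensor hw (isState_prodOp hσ) hτ
  rw [tensor_prodOp_eq σ hτ hp] at h2
  exact h1.unique h2

theorem weight_le_one_iff {τ : QubitOp 2} (hτ : IsState τ) {w : ℕ} (hw : HasWeight τ w) :
    w ≤ 1 ↔ w = 0 ∨ (IsPure (qubitMarginal τ 0) ∨ IsPure (qubitMarginal τ 1)) ∨
      (τ.rank = 2 ∧ ∃ η, IsCornerForm η ∧ LUEquiv τ η) := by
  rw [← hw, rigid_one_iff hτ, isPure_iff_weight hτ hw]

/-- As `w ≤ 2` always, the alternatives exhaust the ways for the sum to be at most 2, with `w ≤ 1`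
resolved by `weight_le_one_iff`. -/
theorem onePairCondition_iff {m : ℕ} {σ : Fin m → Matrix (Fin 2) (Fin 2) ℂ} {τ : QubitOp 2}
    (hσ : ∀ i, IsState (σ i)) (hτ : IsState τ) {w : ℕ} (hw : HasWeight τ w) :
    OnePairCondition σ τ ↔ mixedCount σ + w ≤ 2 := by
  have h2 : w ≤ 2 := (hw 2).1 (rigid_of_card_le le_rfl τ)
  have h1 := weight_le_one_iff hτ hw
  have hb : (IsPure (qubitMarginal τ 0) ∨ IsPure (qubitMarginal τ 1)) →
      (AllButPure 2 (tensor (prodOp σ) τ) ↔ mixedCount σ + w ≤ 2) := fun hp => by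
    rw [tensor_prodOp_eq σ hτ hp,
      allButPure_prodOp_iff (isState_append hσ (isState_qubitMarginal hτ)),
      mixedCount_append_qubitMarginal hσ hτ hp hw]
  rw [OnePairCondition, isPure_iff_weight hτ hw, allButPure_prodOp_iff hσ,
    allButPure_prodOp_iff hσ, isPure_prodOp_iff hσ]
  generalize (IsPure (qubitMarginal τ 0) ∨ IsPure (qubitMarginal τ 1)) = P at *
  generalize (τ.rank = 2 ∧ ∃ η, IsCornerForm η ∧ LUEquiv τ η) = D at *
  constructor
  · rintro (⟨h, h'⟩ | ⟨h, h'⟩ | h | ⟨h, h'⟩)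
    · omega
    · exact (hb h).1 h'
    · omega
    · have := h1.2 (Or.inr (Or.inr h'))
      omega
  · intro h
    by_cases h0 : mixedCount σ = 0
    · exact Or.inr (Or.inr (Or.inl h0))
    · obtain h' | h' | h' := h1.1 (by omega)
      · exact Or.inl ⟨h', by omega⟩
      · exact Or.inr (Or.inl ⟨h', (hb h').2 h⟩)
      · by_cases hs : mixedCount σ ≤ 1
        · exact Or.inr (Or.inr (Or.inr ⟨hs, h'⟩))
        -- Two mixed factors leave `w = 0`, so `τ` is pure.
        · exact Or.inl ⟨by omega, by omega⟩

theorem LUEquiv.tensor {m l : ℕ} {α α' : QubitOp m} {β β' : QubitOp l} (hα : LUEquiv α α')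
    (hβ : LUEquiv β β') : LUEquiv (tensor α β) (tensor α' β') := by
  obtain ⟨U, hU, rfl⟩ := hα
  obtain ⟨V, hV, rfl⟩ := hβ
  refine ⟨Fin.append U V, fun i => ?_, ?_⟩
  · induction i using Fin.addCases with
    | left i => rw [Fin.append_left]; exact hU i
    | right i => rw [Fin.append_right]; exact hV i
  · rw [prodOp_append, tensor_conjTranspose, tensor_mul, tensor_mul]

/-- Trace out either side; unit traces leave no scalar ambiguity. -/
theorem LUEquiv.of_tensor {m l : ℕ} {α α' : QubitOp m} {β β' : QubitOp l} (hα : IsState α)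
    (hα' : IsState α') (hβ : IsState β) (hβ' : IsState β')
    (h : LUEquiv (QuantumMarginal.tensor α β) (QuantumMarginal.tensor α' β')) :
    LUEquiv α α' ∧ LUEquiv β β' := by
  obtain ⟨U, hU, h⟩ := h
  rw [prodOp_eq_tensor, tensor_conjTranspose, tensor_mul, tensor_mul] at h
  have hL := conjTranspose_prodOp_mul_self (U := fun i => U (Fin.castAdd l i)) fun i => hU _
  have hR := conjTranspose_prodOp_mul_self (U := fun i => U (Fin.natAdd m i)) fun i => hU _
  constructor
  · refine ⟨fun i => U (Fin.castAdd l i), fun i => hU _, ?_⟩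
    have := congrArg (fun A => contractRight A 1) h
    simpa only [contractRight_tensor, Matrix.mul_one, hβ'.2, (hβ.conj hR).2, one_smul] using this
  · refine ⟨fun i => U (Fin.natAdd m i), fun i => hU _, ?_⟩
    have := congrArg (fun A => contractLeft A 1) h
    simpa only [contractLeft_tensor, Matrix.mul_one, hα'.2, (hα.conj hL).2, one_smul] using this

theorem twoPairCondition_iff {m : ℕ} {σ : Fin m → Matrix (Fin 2) (Fin 2) ℂ} {τ₁ τ₂ : QubitOp 2}
    (hσ : ∀ i, IsState (σ i)) (hτ₁ : IsState τ₁) (hτ₂ : IsState τ₂) {w₁ w₂ : ℕ}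
    (hw₁ : HasWeight τ₁ w₁) (hw₂ : HasWeight τ₂ w₂) :
    TwoPairCondition σ τ₁ τ₂ ↔ mixedCount σ + w₁ + w₂ ≤ 2 := by
  have h1 := weight_le_one_iff hτ₁ hw₁
  have h2 := weight_le_one_iff hτ₂ hw₂
  rw [TwoPairCondition, isPure_iff_weight hτ₁ hw₁, isPure_iff_weight hτ₂ hw₂,
    onePairCondition_iff hσ hτ₂ hw₂, onePairCondition_iff hσ hτ₁ hw₁,
    onePairCondition_iff (isState_append hσ (isState_qubitMarginal hτ₁)) hτ₂ hw₂,
    onePairCondition_iff (isState_append hσ (isState_qubitMarginal hτ₂)) hτ₁ hw₁,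
    isPure_prodOp_iff hσ]
  constructor
  · rintro ((⟨h, h'⟩ | ⟨h, h'⟩) | (⟨h, h'⟩ | ⟨h, h'⟩) | ⟨hr₁, hr₂, ⟨η₁, η₂, hη₁, hη₂, hl⟩, h⟩)
    · omega
    · omega
    · rw [mixedCount_append_qubitMarginal hσ hτ₁ h hw₁] at h'
      omega
    · rw [mixedCount_append_qubitMarginal hσ hτ₂ h hw₂] at h'
      omega
    · obtain ⟨hl₁, hl₂⟩ := LUEquiv.of_tensor hτ₁ hη₁.1 hτ₂ hη₂.1 hl
      have e1 := h1.2 (Or.inr (Or.inr ⟨hr₁, η₁, hη₁, hl₁⟩))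
      have e2 := h2.2 (Or.inr (Or.inr ⟨hr₂, η₂, hη₂, hl₂⟩))
      omega
  · intro h
    by_cases z1 : w₁ = 0
    · exact Or.inl (Or.inl ⟨z1, by omega⟩)
    by_cases z2 : w₂ = 0
    · exact Or.inl (Or.inr ⟨z2, by omega⟩)
    -- Both weights are now nonzero with total at most 2, hence both are 1 and no single-qubit
    -- factor is mixed.
    obtain h0 | hp | ⟨hr₁, η₁, hη₁, hl₁⟩ := h1.1 (by omega)
    · exact absurd h0 z1
    · refine Or.inr (Or.inl (Or.inl ⟨hp, ?_⟩))
      rwa [mixedCount_append_qubitMarginal hσ hτ₁ hp hw₁]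
    obtain h0 | hp | ⟨hr₂, η₂, hη₂, hl₂⟩ := h2.1 (by omega)
    · exact absurd h0 z2
    · refine Or.inr (Or.inl (Or.inr ⟨hp, ?_⟩))
      rw [mixedCount_append_qubitMarginal hσ hτ₂ hp hw₂]
      omega
    · exact Or.inr (Or.inr ⟨hr₁, hr₂, ⟨η₁, η₂, hη₁, hη₂, hl₁.tensor hl₂⟩, by omega⟩)

/-! ### Assembly of the three characterizations -/

theorem isUDA_tensor_pair_iff {m : ℕ} {σ : Fin m → Matrix (Fin 2) (Fin 2) ℂ} {τ : QubitOp 2}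
    (hσ : ∀ i, IsState (σ i)) (hτ : IsState τ) :
    IsUDA 2 (tensor (prodOp σ) τ) ↔ OnePairCondition σ τ := by
  obtain ⟨w, hw⟩ := exists_hasWeight τ
  have hs := isState_prodOp hσ
  rw [onePairCondition_iff hσ hτ hw, isUDA_iff_rigid (by simp) (hs.tensor hτ)
    ((confining_prodOp one_le_two hσ).tensor (confining_of_card_le le_rfl hτ) hs hτ)]
  exact (hasWeight_prodOp hσ).tensor hw hs hτ 2

theorem isUDA_tensor_two_pairs_iff {m : ℕ} {σ : Fin m → Matrix (Fin 2) (Fin 2) ℂ}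
    {τ₁ τ₂ : QubitOp 2} (hσ : ∀ i, IsState (σ i)) (hτ₁ : IsState τ₁) (hτ₂ : IsState τ₂) :
    IsUDA 2 (tensor (tensor (prodOp σ) τ₁) τ₂) ↔ TwoPairCondition σ τ₁ τ₂ := by
  obtain ⟨w₁, hw₁⟩ := exists_hasWeight τ₁
  obtain ⟨w₂, hw₂⟩ := exists_hasWeight τ₂
  have hs := isState_prodOp hσ
  rw [twoPairCondition_iff hσ hτ₁ hτ₂ hw₁ hw₂,
    isUDA_iff_rigid (by simp) ((hs.tensor hτ₁).tensor hτ₂)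
      (((confining_prodOp one_le_two hσ).tensor (confining_of_card_le le_rfl hτ₁) hs hτ₁).tensor
        (confining_of_card_le le_rfl hτ₂) (hs.tensor hτ₁) hτ₂)]
  exact ((hasWeight_prodOp hσ).tensor hw₁ hs hτ₁).tensor hw₂ (hs.tensor hτ₁) hτ₂ 2

end QuantumMarginal

theorem mainTheorem7 :
    (∀ (n k : ℕ), 1 ≤ k → k ≤ n → ∀ (d : Fin n → ℕ)
      (ρ : ∀ i, Matrix (Fin (d i)) (Fin (d i)) ℂ), (∀ i, QuantumMarginal.IsState (ρ i)) →
        (QuantumMarginal.IsUDA k (QuantumMarginal.prodOp ρ) ↔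
          n - k ≤ {i : Fin n |
            QuantumMarginal.IsPure
              (QuantumMarginal.marginal {i} (QuantumMarginal.prodOp ρ))}.ncard)) ∧
    (∀ (m : ℕ) (σ : Fin m → Matrix (Fin 2) (Fin 2) ℂ) (τ : QuantumMarginal.QubitOp 2),
      (∀ i, QuantumMarginal.IsState (σ i)) → QuantumMarginal.IsState τ →
        ((QuantumMarginal.IsPure (QuantumMarginal.qubitMarginal τ 0) ∨
            QuantumMarginal.IsPure (QuantumMarginal.qubitMarginal τ 1) →
          QuantumMarginal.tensor (QuantumMarginal.prodOp σ) τ =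
            QuantumMarginal.prodOp (Fin.append σ (QuantumMarginal.qubitMarginal τ))) ∧
        (QuantumMarginal.IsUDA 2 (QuantumMarginal.tensor (QuantumMarginal.prodOp σ) τ) ↔
          QuantumMarginal.OnePairCondition σ τ))) ∧
    (∀ (m : ℕ) (σ : Fin m → Matrix (Fin 2) (Fin 2) ℂ) (τ₁ τ₂ : QuantumMarginal.QubitOp 2),
      (∀ i, QuantumMarginal.IsState (σ i)) →
      QuantumMarginal.IsState τ₁ → QuantumMarginal.IsState τ₂ →
        ((QuantumMarginal.IsPure (QuantumMarginal.qubitMarginal τ₁ 0) ∨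
            QuantumMarginal.IsPure (QuantumMarginal.qubitMarginal τ₁ 1) →
          τ₁ = QuantumMarginal.prodOp (QuantumMarginal.qubitMarginal τ₁)) ∧
        (QuantumMarginal.IsPure (QuantumMarginal.qubitMarginal τ₂ 0) ∨
            QuantumMarginal.IsPure (QuantumMarginal.qubitMarginal τ₂ 1) →
          τ₂ = QuantumMarginal.prodOp (QuantumMarginal.qubitMarginal τ₂)) ∧
        (QuantumMarginal.IsUDA 2
            (QuantumMarginal.tensor
              (QuantumMarginal.tensor (QuantumMarginal.prodOp σ) τ₁) τ₂) ↔
          QuantumMarginal.TwoPairCondition σ τ₁ τ₂))) := by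
  refine ⟨fun n k hk hkn d ρ hρ => ?_, fun m σ τ hσ hτ => ?_, fun m σ τ₁ τ₂ hσ hτ₁ hτ₂ => ?_⟩
  · have h := QuantumMarginal.isUDA_prodOp_iff hk (by simpa using hkn) hρ
    rwa [QuantumMarginal.AllButPure, Fintype.card_fin] at h
  · exact ⟨QuantumMarginal.tensor_prodOp_eq σ hτ, QuantumMarginal.isUDA_tensor_pair_iff hσ hτ⟩
  · exact ⟨QuantumMarginal.eq_prodOp_qubitMarginal hτ₁, QuantumMarginal.eq_prodOp_qubitMarginal hτ₂,
      QuantumMarginal.isUDA_tensor_two_pairs_iff hσ hτ₁ hτ₂⟩
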